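/- Let $\mathcal X,\mathcal Y$ be finite sets, let $W(y\mid x)$ be the transition probabilities of a discrete memoryless channel, $W^n(\boldsymbol y\mid\boldsymbol x)=\prod_{i=1}^n W(y_i\mid x_i)$, let $Q$ be a probability distribution on $\mathcal X$, let $g:\mathcal P(\mathcal X\times\mathcal Y)\to\mathbb R$ be a continuous function on the simplex of probability distributions on $\mathcal X\times\mathcal Y$, let $L\ge 1$ be a fixed integer, and let $(M_n)$ be integers with $M_n\ge 2$ for all large $n$ and $\frac1n\log M_n\to R$. For all large $n$ let $Q_n$ be an $n$-length type over $\mathcal X$ (an empirical distribution of a sequence in $\mathcal X^n$) with the same support as $Q$ and $\max_x|Q_n(x)-Q(x)|\le \frac1n$. Draw $M_n$ codewords $\boldsymbol X_1,\dots,\boldsymbol X_{M_n}$ independently and uniformly from the set of all sequences in $\mathcal X^n$ of type $Q_n$. A message $m$, uniform on $\{1,\dots,M_n\}$, is sent as $\boldsymbol X_m$ over the channel and $\boldsymbol Y\sim W^n(\cdot\mid \boldsymbol X_m)$ is received. The randomised list decoder draws $L$ messages independently (repetitions allowed), each equal to $m'$ with probability $u_n(\boldsymbol X_{m'},\boldsymbol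 Y)/\sum_{m''=1}^{M_n}u_n(\boldsymbol X_{m''},\boldsymbol Y)$, where $u_n(\boldsymbol x,\boldsymbol y)=e^{n g(\hat P_{\boldsymbol x,\boldsymbol y})}$ and $\hat P_{\boldsymbol x,\boldsymbol y}$ is the joint type (empirical distribution) of $(\boldsymbol x,\boldsymbol y)$. Let $\bar p_e(n,L)$ be the probability, over the random code, the message, the channel and the decoder, that $m$ is not in the list. Then $\bar p_e(n,L)>0$ for all large $n$, and the random-coding error exponent exists and is given exactly (i.e. it is ensemble-tight) by $$\lim_{n\to\infty}-\frac1n\log\bar p_e(n,L)=E_1(R,Q,L),$$ where $$E_1(R,Q,L)=\min_{P_{XY}:\,P_X=Q}\ \min_{\tilde P_{XY}:\,\tilde P_X=Q,\ \tilde P_Y=P_Y} D(P_{XY}\,\|\,Q\times W)+[I_{\tilde P}(X\colon Y)-R]_+ +L\Big[g(P_{XY})-g(\tilde P_{XY})-[R-I_{\tilde P}(X\colon Y)]_+\Big]_+,$$ the minimum being attained. Here $P_{XY},\tilde P_{XY}$ range over probability distributions on $\mathcal X\times\mathcal Y$, $(Q\times W)(x,y)=Q(x)W(y\mid x)$, $D$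 is relative entropy ($+\infty$ when $P_{XY}\not\ll Q\times W$), $I_P(X\colon Y)$ is mutual information, logarithms are natural, and $[a]_+=\max(a,0)$. -/

import Mathlib

open Filter Topology

noncomputable section

namespace ListDecoding

/-- The type (empirical distribution) of a sequence of length `n`. -/
def empiricalDist {α : Type*} [DecidableEq α] {n : ℕ} (z : Fin n → α) : α → ℝ :=
  fun a => ((Finset.univ.filter fun i => z i = a).card : ℝ) / n

/-- The set of `n`-length types over `α`. -/
def types (α : Type*) [DecidableEq α] (n : ℕ) : Set (α → ℝ) :=
  Set.range fun z : Fin n → α => empiricalDist z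

open Classical in
/-- The type class of `q`: all sequences of length `n` whose type is `q`. -/
def typeClass {α : Type*} [Fintype α] [DecidableEq α] (n : ℕ) (q : α → ℝ) :
    Finset (Fin n → α) :=
  Finset.univ.filter fun z => empiricalDist z = q

open Classical in
/-- Constant-composition random-coding law: uniform on the type class of `q`. -/
def codewordProb {X : Type*} [Fintype X] [DecidableEq X] {n : ℕ} (q : X → ℝ)
    (x : Fin n → X) : ℝ :=
  if x ∈ typeClass n q then 1 / ((typeClass n q).card : ℝ) else 0

/-- Memoryless channel law `Wⁿ(y | x) = ∏ᵢ W(yᵢ | xᵢ)`, with `W x y` standing for `W(y | x)`. -/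
def channelProb {X Y : Type*} {n : ℕ} (W : X → Y → ℝ) (x : Fin n → X) (y : Fin n → Y) : ℝ :=
  ∏ i, W (x i) (y i)

/-- Decoding metric `exp (n g(joint type of (x, y)))`. -/
def metric {X Y : Type*} [DecidableEq X] [DecidableEq Y] {n : ℕ} (g : (X × Y → ℝ) → ℝ)
    (x : Fin n → X) (y : Fin n → Y) : ℝ :=
  Real.exp (n * g (empiricalDist fun i => (x i, y i)))

/-- Probability that one draw of the randomised decoder, for the code `c` and the received
sequence `y`, is the message `m`. -/
def decodeProb {X Y : Type*} [DecidableEq X] [DecidableEq Y] {n M : ℕ} (g : (X × Y → ℝ) → ℝ)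
    (c : Fin M → Fin n → X) (y : Fin n → Y) (m : Fin M) : ℝ :=
  metric g (c m) y / ∑ m', metric g (c m') y

/-- Probability that a list of `L` independent draws of the randomised decoder does not contain
the message `m`. -/
def listErrorProb {X Y : Type*} [DecidableEq X] [DecidableEq Y] {n M : ℕ}
    (g : (X × Y → ℝ) → ℝ) (L : ℕ) (c : Fin M → Fin n → X) (y : Fin n → Y) (m : Fin M) : ℝ :=
  ∑ l ∈ Finset.univ.filter (fun l : Fin L → Fin M => ∀ i, l i ≠ m), ∏ i, decodeProb g c y (l i)

/-- Average list-decoding error probability: `M` codewords of length `n` are drawn independently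
and uniformly from the type class of `q`, a uniform message is sent over the channel `W`, and the
receiver draws a list of `L` messages. -/
def avgErrorProb {X Y : Type*} [Fintype X] [DecidableEq X] [Fintype Y] [DecidableEq Y]
    (W : X → Y → ℝ) (g : (X × Y → ℝ) → ℝ) (q : X → ℝ) (M L n : ℕ) : ℝ :=
  ∑ c : Fin M → Fin n → X, (∏ m, codewordProb q (c m)) *
    ((1 / (M : ℝ)) * ∑ m, ∑ y : Fin n → Y, channelProb W (c m) y * listErrorProb g L c y m)

/-- First marginal `P_X`. -/
def marginalX {X Y : Type*} [Fintype Y] (P : X × Y → ℝ) : X → ℝ := fun x => ∑ y, P (x, y)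

/-- Second marginal `P_Y`. -/
def marginalY {X Y : Type*} [Fintype X] (P : X × Y → ℝ) : Y → ℝ := fun y => ∑ x, P (x, y)

/-- The joint distribution `Q × W`. -/
def inputChannel {X Y : Type*} (Q : X → ℝ) (W : X → Y → ℝ) : X × Y → ℝ :=
  fun z => Q z.1 * W z.1 z.2

open Classical in
/-- Relative entropy `D(p ‖ q)` on a finite alphabet, in nats; it is `⊤` unless `p ≪ q`. -/
def relEntropy {α : Type*} [Fintype α] (p q : α → ℝ) : EReal :=
  if ∀ a, q a = 0 → p a = 0 then ((∑ a, p a * Real.log (p a / q a) : ℝ) : EReal) else ⊤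

/-- Mutual information `I_P(X : Y)`, in nats. -/
def mutualInfo {X Y : Type*} [Fintype X] [Fintype Y] (P : X × Y → ℝ) : ℝ :=
  ∑ z, P z * Real.log (P z / (marginalX P z.1 * marginalY P z.2))

/-- Joint distributions `P` with `P_X = Q`. -/
def jointWithInput {X Y : Type*} [Fintype X] [Fintype Y] (Q : X → ℝ) : Set (X × Y → ℝ) :=
  {P | P ∈ stdSimplex ℝ (X × Y) ∧ marginalX P = Q}

/-- Joint distributions `P'` with `P'_X = Q` and `P'_Y = P_Y`. -/
def jointWithMarginals {X Y : Type*} [Fintype X] [Fintype Y] (Q : X → ℝ) (P : X × Y → ℝ) :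
    Set (X × Y → ℝ) :=
  {P' | P' ∈ stdSimplex ℝ (X × Y) ∧ marginalX P' = Q ∧ marginalY P' = marginalY P}

/-- `D(P ‖ Q × W) + [I_{P'} - R]₊ + L [g(P) - g(P') - [R - I_{P'}]₊]₊`. -/
def exponentObjective {X Y : Type*} [Fintype X] [Fintype Y] (W : X → Y → ℝ)
    (g : (X × Y → ℝ) → ℝ) (R : ℝ) (Q : X → ℝ) (L : ℕ) (P P' : X × Y → ℝ) : EReal :=
  relEntropy P (inputChannel Q W) +
    ((max (mutualInfo P' - R) 0 + L * max (g P - g P' - max (R - mutualInfo P') 0) 0 : ℝ) : EReal)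

/-- The exponent `E₁(R, Q, L)`. -/
def exponentE1 {X Y : Type*} [Fintype X] [Fintype Y] (W : X → Y → ℝ)
    (g : (X × Y → ℝ) → ℝ) (R : ℝ) (Q : X → ℝ) (L : ℕ) : EReal :=
  ⨅ P ∈ jointWithInput (Y := Y) Q, ⨅ P' ∈ jointWithMarginals Q P, exponentObjective W g R Q L P P'

end ListDecoding

end

/-! Fix the joint type `P` of the sent codeword and the output. The L draws are independent, so the
list misses the message with probability `(S / (u + S)) ^ L`, where `u` is the metric of the sent
codeword and `S` the sum of the competing metrics. Up to constants, `S / (u + S)` is `min 1 (S /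
u)`, and `S / u` is the sum over joint types `P'` of `exp (n (g P' - g P))` times the number `N` of
competitors having joint type `P'` with the output. There are only polynomially many types, so sums
over types may be replaced by maxima at no exponential cost.

For one `P'`, `N` is binomial with mean `λ = (M - 1) p`, where the method of types gives `p ≈ exp
(-n I(P'))`. The heart of the proof is that `E [min 1 (a N) ^ L]` equals `min 1 λ * min 1 (a * max 1
λ) ^ L` up to constants depending only on L (`sum_prod_mul_min_hits_pow_le`,
`le_sum_prod_mul_min_hits_pow`): `N` is nonzero with probability about `min 1 λ`, and is then of
order `max 1 λ`. With `λ ≈ exp (-n (I - R))` and `a = exp (-n (g P - g P'))`, the two factors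
produce the two positive parts of the exponent. The probability of the joint type `P` itself
contributes the divergence.

Hence each pair of types contributes `exp (-n r)` with `r` uniformly close to a real objective that
is continuous on pairs of distributions (`exists_rate_pairTerm`, `continuousOn_rateObjective`). It
remains to compare optimisation over types with optimisation over distributions. For the upper bound
on the error, pairs of types nearly satisfy the limiting constraints, and compactness prevents their
objective from falling much below the minimum (`exists_pos_forall_sub_lt_rateObjective`). For the
lower bound, a minimising pair must be rounded to types that satisfy all marginal and support
constraints exactly (`exists_feasibleTypes_near`). -/

noncomputable section

/-! ### Method of types: number of types and size of a type class. -/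

namespace ListDecoding

/-- Shannon entropy, in nats. -/
def entropy {α : Type*} [Fintype α] (p : α → ℝ) : ℝ := ∑ a, Real.negMulLog (p a)

section Types

variable {α : Type*} [DecidableEq α] {n : ℕ}

theorem empiricalDist_nonneg (z : Fin n → α) (a : α) : 0 ≤ empiricalDist z a := by
  unfold empiricalDist; positivity

theorem natCast_mul_empiricalDist (z : Fin n → α) (a : α) :
    n * empiricalDist z a = ((Finset.univ.filter fun i => z i = a).card : ℝ) := by
  unfold empiricalDist
  rcases Nat.eq_zero_or_pos n with rfl | hn
  · simp
  · field_simp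

theorem empiricalDist_eq_iff_card (z w : Fin n → α) :
    empiricalDist z = empiricalDist w ↔ ∀ a,
      (Finset.univ.filter fun i => z i = a).card = (Finset.univ.filter fun i => w i = a).card := by
  constructor
  · intro h a
    have := natCast_mul_empiricalDist z a
    rw [h, natCast_mul_empiricalDist w a] at this
    exact_mod_cast this.symm
  · intro h
    funext a
    unfold empiricalDist
    rw [h a]

theorem empiricalDist_comp_perm (z : Fin n → α) (σ : Equiv.Perm (Fin n)) :
    empiricalDist (z ∘ σ) = empiricalDist z := by
  rw [empiricalDist_eq_iff_card]
  intro a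
  apply Finset.card_bij (fun i _ => σ i)
  · intro i hi; simpa using hi
  · intro i _ j _ h; exact σ.injective h
  · intro j hj; exact ⟨σ.symm j, by simpa using hj, by simp⟩

theorem exists_perm_of_empiricalDist_eq {z w : Fin n → α}
    (h : empiricalDist z = empiricalDist w) : ∃ σ : Equiv.Perm (Fin n), w ∘ σ = z := by
  rw [empiricalDist_eq_iff_card] at h
  have e : ∀ a, Nonempty ({i // z i = a} ≃ {i // w i = a}) := fun a =>
    Fintype.card_eq.1 (by rw [Fintype.card_subtype, Fintype.card_subtype]; exact h a)
  exact ⟨Equiv.ofFiberEquiv fun a => (e a).some, funext fun i => Equiv.ofFiberEquiv_map _ i⟩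

variable [Fintype α]

theorem mem_typeClass {q : α → ℝ} {z : Fin n → α} : z ∈ typeClass n q ↔ empiricalDist z = q := by
  simp [typeClass]

theorem sum_card_fiber (z : Fin n → α) :
    ∑ a, (Finset.univ.filter fun i => z i = a).card = n := by
  rw [← Finset.card_eq_sum_card_fiberwise (s := Finset.univ) (t := Finset.univ) (f := z) (by simp)]
  simp

theorem sum_empiricalDist (hn : 0 < n) (z : Fin n → α) : ∑ a, empiricalDist z a = 1 := by
  have h : (n : ℝ) * ∑ a, empiricalDist z a = n := by
    rw [Finset.mul_sum]
    simp_rw [natCast_mul_empiricalDist]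
    exact_mod_cast sum_card_fiber z
  have : (n : ℝ) ≠ 0 := by positivity
  field_simp at h
  exact h

theorem empiricalDist_mem_stdSimplex (hn : 0 < n) (z : Fin n → α) :
    empiricalDist z ∈ stdSimplex ℝ α :=
  ⟨empiricalDist_nonneg z, sum_empiricalDist hn z⟩

/-- Orbit counting: permutations of the coordinates act transitively on the type class, and each
fibre of `σ ↦ z ∘ σ` is a coset of the stabiliser of `z`, whose order is the product of the
factorials. -/
theorem card_typeClass_mul_prod_factorial (z : Fin n → α) :
    (typeClass n (empiricalDist z)).card *
      ∏ a, ((Finset.univ.filter fun i => z i = a).card).factorial = n.factorial := by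
  classical
  have h1 : ∀ w ∈ typeClass n (empiricalDist z),
      (Finset.univ.filter fun σ : Equiv.Perm (Fin n) => z ∘ σ = w).card =
        ∏ a, ((Finset.univ.filter fun i => z i = a).card).factorial := by
    intro w hw
    obtain ⟨σ₀, h0⟩ := exists_perm_of_empiricalDist_eq (mem_typeClass.1 hw)
    have h2 := DomMulAct.stabilizer_card z
    simp_rw [Fintype.card_subtype] at h2
    rw [← h2]
    apply Finset.card_bij (fun σ _ => σ * σ₀⁻¹)
    · intro σ hσ
      simp only [Finset.mem_filter, Finset.mem_univ, true_and] at hσ ⊢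
      funext i
      have h3 := congrFun (hσ.trans h0.symm) (σ₀⁻¹ i)
      simpa using h3
    · intro σ _ τ _ h
      exact mul_right_cancel h
    · intro τ hτ
      simp only [Finset.mem_filter, Finset.mem_univ, true_and] at hτ
      refine ⟨τ * σ₀, ?_, by simp⟩
      simp only [Finset.mem_filter, Finset.mem_univ, true_and]
      rw [← h0]
      funext i
      exact congrFun hτ (σ₀ i)
  have h2 := Finset.card_eq_sum_card_fiberwise (s := (Finset.univ : Finset (Equiv.Perm (Fin n))))
    (t := typeClass n (empiricalDist z)) (f := fun σ : Equiv.Perm (Fin n) => z ∘ σ)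
    (fun σ _ => mem_typeClass.2 (empiricalDist_comp_perm z σ))
  rw [Finset.sum_congr rfl h1, Finset.sum_const, smul_eq_mul, Finset.card_univ, Fintype.card_perm,
    Fintype.card_fin] at h2
  exact h2.symm

/-- The finite set of `n`-length types. -/
def typeFinset (α : Type*) [Fintype α] [DecidableEq α] (n : ℕ) : Finset (α → ℝ) := by
  classical exact Finset.univ.image fun z : Fin n → α => empiricalDist z

theorem mem_typeFinset {q : α → ℝ} : q ∈ typeFinset α n ↔ q ∈ types α n := by
  simp [typeFinset, types]

theorem card_typeFinset_le : (typeFinset α n).card ≤ (n + 1) ^ Fintype.card α := by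
  classical
  have h : typeFinset α n ⊆ Finset.univ.image
      (fun (k : α → Fin (n + 1)) (a : α) => ((k a : ℕ) : ℝ) / n) := by
    intro q hq
    obtain ⟨z, rfl⟩ := mem_typeFinset.1 hq
    refine Finset.mem_image.2 ⟨fun a => ⟨(Finset.univ.filter fun i => z i = a).card, ?_⟩,
      Finset.mem_univ _, rfl⟩
    exact Nat.lt_succ_of_le ((Finset.card_le_univ _).trans (by simp))
  refine (Finset.card_le_card h).trans (Finset.card_image_le.trans ?_)
  simp

end Types

theorem log_factorial_ge (n : ℕ) : n * Real.log n - n ≤ Real.log n.factorial := by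
  rcases Nat.eq_zero_or_pos n with rfl | hn
  · simp
  · have h := Stirling.le_log_factorial_stirling hn.ne'
    have h1 : 0 ≤ Real.log n := Real.log_natCast_nonneg n
    have h2 : 0 ≤ Real.log (2 * Real.pi) :=
      Real.log_nonneg (by nlinarith [Real.pi_gt_three])
    linarith

/-- A crude logarithmic slack keeps the induction elementary: its growth `2 log ((k + 2) / (k + 1))
≥ 2 / (k + 2)` covers the deficit `1 - k log ((k + 1) / k) ≤ 1 / (k + 1)`. -/
theorem log_factorial_le (n : ℕ) :
    Real.log n.factorial ≤ n * Real.log n - n + (2 * Real.log (n + 1) + 1) := by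
  induction n with
  | zero => simp
  | succ k ih =>
    rw [Nat.factorial_succ, Nat.cast_mul, Real.log_mul (by positivity) (by positivity)]
    push_cast
    have h2 : 1 / ((k : ℝ) + 2) ≤ Real.log (k + 1 + 1) - Real.log (k + 1) := by
      rw [← Real.log_div (by positivity) (by positivity)]
      refine le_trans (le_of_eq ?_) (Real.one_sub_inv_le_log_of_pos (by positivity))
      field_simp
      ring
    have h3 : (k : ℝ) / (k + 1) ≤ k * (Real.log (k + 1) - Real.log k) := by
      rcases Nat.eq_zero_or_pos k with rfl | hk
      · simp
      rw [← Real.log_div (by positivity) (by positivity), div_eq_mul_one_div]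
      refine mul_le_mul_of_nonneg_left (le_trans (le_of_eq ?_)
        (Real.one_sub_inv_le_log_of_pos (by positivity))) (by positivity)
      field_simp
      ring
    have h4 : (1 : ℝ) ≤ k / (k + 1) + 2 * (1 / (k + 2)) := by
      rw [div_add' _ _ _ (by positivity), le_div_iff₀ (by positivity)]
      field_simp
      nlinarith
    linarith

/-- Error term in the entropy estimate of the size of a type class. -/
def typeErr (n : ℕ) : ℝ := 2 * Real.log (n + 1) + 1

theorem typeErr_pos (n : ℕ) : 0 < typeErr n := by
  have : 0 ≤ Real.log ((n : ℝ) + 1) := Real.log_nonneg (by linarith [n.cast_nonneg (α := ℝ)])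
  unfold typeErr; linarith

theorem typeErr_mono {m n : ℕ} (h : m ≤ n) : typeErr m ≤ typeErr n := by
  unfold typeErr
  gcongr

variable {α : Type*} [DecidableEq α] [Fintype α] {n : ℕ}

theorem card_typeClass_pos (z : Fin n → α) : 0 < (typeClass n (empiricalDist z)).card :=
  Finset.card_pos.2 ⟨z, mem_typeClass.2 rfl⟩

/-- Take logarithms in the multinomial formula and apply the factorial bounds to `n` and to every
count. The linear terms cancel because the counts sum to `n`, leaving one error term per factorial.
-/
theorem abs_log_card_typeClass_sub (z : Fin n → α) :
    |Real.log (typeClass n (empiricalDist z)).card - n * entropy (empiricalDist z)| ≤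
      (Fintype.card α + 1) * typeErr n := by
  rcases Nat.eq_zero_or_pos n with rfl | hn
  · have h1 : (typeClass 0 (empiricalDist z)).card = 1 :=
      le_antisymm ((Finset.card_le_univ _).trans (by simp)) (card_typeClass_pos z)
    rw [h1]
    have := typeErr_pos 0
    simp only [Nat.cast_one, Real.log_one, Nat.cast_zero, zero_mul, sub_zero, abs_zero]
    positivity
  have h := congrArg (fun k : ℕ => Real.log k) (card_typeClass_mul_prod_factorial z)
  simp only [Nat.cast_mul, Nat.cast_prod] at h
  rw [Real.log_mul (by have := card_typeClass_pos z; positivity)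
    (Finset.prod_ne_zero_iff.2 fun a _ => by positivity),
    Real.log_prod (fun a _ => by positivity)] at h
  set N : α → ℕ := fun a => (Finset.univ.filter fun i => z i = a).card with hN
  have hNn : ∀ a, N a ≤ n := fun a => (Finset.card_le_univ _).trans (by simp)
  have hs : ∑ a, (N a : ℝ) = n := by exact_mod_cast sum_card_fiber z
  have hent : n * entropy (empiricalDist z) =
      n * Real.log n - ∑ a, (N a : ℝ) * Real.log (N a) := by
    unfold entropy
    rw [Finset.mul_sum, ← hs, Finset.sum_mul, ← Finset.sum_sub_distrib]
    refine Finset.sum_congr rfl fun a _ => ?_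
    rw [hs, Real.negMulLog, show empiricalDist z a = (N a : ℝ) / n from rfl]
    rcases Nat.eq_zero_or_pos (N a) with h0 | h0
    · simp [h0]
    · rw [Real.log_div (by positivity) (by positivity)]
      field_simp
      ring
  have hlow : ∑ a, ((N a : ℝ) * Real.log (N a)) - n ≤ ∑ a, Real.log (N a).factorial := by
    rw [← hs, ← Finset.sum_sub_distrib]
    exact Finset.sum_le_sum fun a _ => log_factorial_ge _
  have hup : ∑ a, Real.log (N a).factorial ≤
      ∑ a, ((N a : ℝ) * Real.log (N a)) - n + Fintype.card α * typeErr n := by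
    calc ∑ a, Real.log (N a).factorial
        ≤ ∑ a, ((N a : ℝ) * Real.log (N a) - N a + typeErr n) :=
          Finset.sum_le_sum fun a _ => (log_factorial_le _).trans
            (add_le_add_right (typeErr_mono (hNn a)) _)
      _ = _ := by
          rw [Finset.sum_add_distrib, Finset.sum_sub_distrib, hs]; simp
  have h1 := log_factorial_ge n
  have h2 : Real.log n.factorial ≤ n * Real.log n - n + typeErr n := log_factorial_le n
  have := typeErr_pos n
  have h4 : 0 ≤ (Fintype.card α : ℝ) * typeErr n := by positivity
  rw [hent, abs_le]
  change _ + ∑ a, Real.log (N a).factorial = _ at h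
  constructor <;> nlinarith

end ListDecoding

end

/-! ### Truncated moments of a binomial count, up to constants. -/

noncomputable section

namespace ListDecoding

section ProductLaw

variable {β ι : Type*} [Fintype β] [Fintype ι] [DecidableEq ι]

theorem sum_prod_mul_prod (w φ : β → ℝ) :
    ∑ c : ι → β, (∏ j, w (c j)) * ∏ j, φ (c j) = (∑ b, w b * φ b) ^ Fintype.card ι := by
  simp_rw [← Finset.prod_mul_distrib]
  have h := Finset.prod_univ_sum (fun _ : ι => (Finset.univ : Finset β))
    (fun _ b => w b * φ b)
  rw [Fintype.piFinset_univ] at h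
  rw [← h, Finset.prod_const, Finset.card_univ]

theorem sum_prod_eq_one {w : β → ℝ} (hw : ∑ b, w b = 1) :
    ∑ c : ι → β, ∏ j, w (c j) = 1 := by
  have h := sum_prod_mul_prod (ι := ι) w (fun _ => 1)
  simpa [hw] using h

variable (T : β → Prop) [DecidablePred T]

/-- Number of coordinates of `c` that satisfy `T`. -/
def hits (c : ι → β) : ℕ := (Finset.univ.filter fun j => T (c j)).card

omit [Fintype β] [DecidableEq ι] in
theorem exp_mul_hits (t : ℝ) (c : ι → β) :
    Real.exp (t * hits T c) = ∏ j, (if T (c j) then Real.exp t else 1) := by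
  rw [Finset.prod_ite, Finset.prod_const, Finset.prod_const_one, mul_one, hits, mul_comm,
    Real.exp_nat_mul]

variable {T} {w : β → ℝ} (hw0 : ∀ b, 0 ≤ w b) (hw : ∑ b, w b = 1)
  {p : ℝ} (hp : p = ∑ b, if T b then w b else 0)
include hw0 hw hp

theorem sum_prod_mul_exp_hits_le (t : ℝ) :
    ∑ c : ι → β, (∏ j, w (c j)) * Real.exp (t * hits T c) ≤
      Real.exp (Fintype.card ι * p * (Real.exp t - 1)) := by
  simp_rw [exp_mul_hits T t]
  rw [sum_prod_mul_prod w (fun b => if T b then Real.exp t else 1)]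
  have h1 : ∑ b, w b * (if T b then Real.exp t else 1) = 1 + p * (Real.exp t - 1) := by
    have h2 : ∑ b, w b * (if T b then Real.exp t else 1) =
        ∑ b, w b + (∑ b, if T b then w b else 0) * (Real.exp t - 1) := by
      rw [Finset.sum_mul, ← Finset.sum_add_distrib]
      refine Finset.sum_congr rfl fun b _ => ?_
      split_ifs <;> ring
    rw [h2, hw, hp]
  have h0 : 0 ≤ ∑ b, w b * (if T b then Real.exp t else 1) :=
    Finset.sum_nonneg fun b _ => mul_nonneg (hw0 b) (by split_ifs <;> positivity)
  calc _ ≤ (Real.exp (p * (Real.exp t - 1))) ^ Fintype.card ι := by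
        refine pow_le_pow_left₀ h0 ?_ _
        rw [h1, add_comm]
        exact Real.add_one_le_exp _
    _ = _ := by rw [← Real.exp_nat_mul]; ring_nf

/-- The moment is dominated by `L! (exp (t N) - 1)` with `t = 1 / max 1 λ`. Subtracting 1, possible
because `L ≥ 1`, is what yields the factor `min 1 λ` when the mean is small. -/
theorem sum_prod_mul_hits_pow_le {L : ℕ} (hL : 1 ≤ L) :
    ∑ c : ι → β, (∏ j, w (c j)) * ((hits T c : ℝ) / max 1 (Fintype.card ι * p)) ^ L ≤
      16 * L.factorial * min 1 (Fintype.card ι * p) := by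
  have hp0 : 0 ≤ p := by
    rw [hp]; exact Finset.sum_nonneg fun b _ => by split_ifs <;> simp [hw0]
  have hmgf := sum_prod_mul_exp_hits_le (ι := ι) hw0 hw hp (max 1 (Fintype.card ι * p))⁻¹
  set lam : ℝ := Fintype.card ι * p with hlam
  have hl0 : 0 ≤ lam := by positivity
  set t : ℝ := (max 1 lam)⁻¹ with ht
  have hm : 1 ≤ max 1 lam := le_max_left _ _
  have ht0 : 0 < t := by positivity
  have ht1 : t ≤ 1 := inv_le_one_of_one_le₀ hm
  have hlt : lam * t = min 1 lam := by
    rcases le_total 1 lam with h | h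
    · rw [ht, max_eq_right h, min_eq_left h]; field_simp
    · rw [ht, max_eq_left h, min_eq_right h]; simp
  have he : Real.exp t - 1 ≤ 2 * t := by
    have := (abs_le.1 (Real.abs_exp_sub_one_sub_id_le (x := t) (by rwa [abs_of_pos ht0]))).2
    nlinarith
  have hμ0 : 0 ≤ min 1 lam := le_min zero_le_one hl0
  have hμ1 : min 1 lam ≤ 1 := min_le_left _ _
  -- `exp x - 1 ≤ x exp x` at `x = 2 min 1 λ ≤ 2`, with `exp 2 ≤ 8`.
  have h16 : Real.exp (2 * min 1 lam) - 1 ≤ 16 * min 1 lam := by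
    have h1 := Real.add_one_le_exp (-(2 * min 1 lam))
    have h2 : Real.exp (2 * min 1 lam) ≤ 8 := by
      calc Real.exp (2 * min 1 lam) ≤ Real.exp (1 + 1) := Real.exp_le_exp.2 (by linarith)
        _ = Real.exp 1 * Real.exp 1 := Real.exp_add _ _
        _ ≤ 8 := by nlinarith [Real.exp_one_lt_d9, Real.exp_pos 1]
    have h3 := Real.exp_pos (2 * min 1 lam)
    have h4 : Real.exp (2 * min 1 lam) * Real.exp (-(2 * min 1 lam)) = 1 := by
      rw [← Real.exp_add]; simp
    nlinarith
  have key : ∀ c : ι → β, ((hits T c : ℝ) / max 1 lam) ^ L ≤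
      L.factorial * (Real.exp (t * hits T c) - 1) := by
    intro c
    have hx : (hits T c : ℝ) / max 1 lam = t * hits T c := by rw [ht]; field_simp
    rw [hx]
    have hx0 : 0 ≤ t * hits T c := by positivity
    have h1 := Real.sum_le_exp_of_nonneg hx0 (L + 1)
    rw [Finset.sum_range_succ] at h1
    have h2 : (1 : ℝ) ≤ ∑ i ∈ Finset.range L, (t * hits T c) ^ i / (i.factorial : ℝ) := by
      have := Finset.single_le_sum (f := fun i => (t * hits T c) ^ i / (i.factorial : ℝ))
        (fun i _ => by positivity) (Finset.mem_range.2 hL)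
      simpa using this
    have h3 : (t * hits T c) ^ L / (L.factorial : ℝ) ≤ Real.exp (t * hits T c) - 1 := by linarith
    rw [div_le_iff₀ (by positivity)] at h3
    linarith
  have hprod : ∀ c : ι → β, 0 ≤ ∏ j, w (c j) := fun c => Finset.prod_nonneg fun j _ => hw0 _
  calc _ ≤ ∑ c : ι → β, (∏ j, w (c j)) * (L.factorial * (Real.exp (t * hits T c) - 1)) :=
        Finset.sum_le_sum fun c _ => mul_le_mul_of_nonneg_left (key c) (hprod c)
    _ = L.factorial * (∑ c : ι → β, (∏ j, w (c j)) * Real.exp (t * hits T c) - 1) := by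
        have h : ∑ c : ι → β, (∏ j, w (c j)) * (L.factorial * (Real.exp (t * hits T c) - 1)) =
            L.factorial * (∑ c : ι → β, (∏ j, w (c j)) * Real.exp (t * hits T c) -
              ∑ c : ι → β, ∏ j, w (c j)) := by
          rw [← Finset.sum_sub_distrib, Finset.mul_sum]
          exact Finset.sum_congr rfl fun c _ => by ring
        rw [h, sum_prod_eq_one hw]
    _ ≤ L.factorial * (Real.exp (2 * min 1 lam) - 1) := by
        gcongr
        refine hmgf.trans (Real.exp_le_exp.2 ?_)
        rw [← hlt]
        nlinarith
    _ ≤ L.factorial * (16 * min 1 lam) := by gcongr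
    _ = _ := by ring

/-- If `a max 1 λ ≤ 1`, drop the truncation and use the moment bound. Otherwise only `min 1 λ` is
needed: for `λ ≤ 1` integrality gives `min 1 (a N) ≤ N`, and for `λ ≥ 1` the truncation at 1
suffices. -/
theorem sum_prod_mul_min_hits_pow_le {L : ℕ} (hL : 1 ≤ L) {a : ℝ} (ha : 0 ≤ a) :
    ∑ c : ι → β, (∏ j, w (c j)) * (min 1 (a * hits T c)) ^ L ≤
      16 * L.factorial * (min 1 (Fintype.card ι * p) *
        (min 1 (a * max 1 (Fintype.card ι * p))) ^ L) := by
  have hp0 : 0 ≤ p := by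
    rw [hp]; exact Finset.sum_nonneg fun b _ => by split_ifs <;> simp [hw0]
  have hmom := sum_prod_mul_hits_pow_le (ι := ι) hw0 hw hp hL
  set lam : ℝ := Fintype.card ι * p with hlam
  have hl0 : 0 ≤ lam := by positivity
  have hm : 1 ≤ max 1 lam := le_max_left _ _
  have hm0 : 0 < max 1 lam := by positivity
  have hprod : ∀ c : ι → β, 0 ≤ ∏ j, w (c j) := fun c => Finset.prod_nonneg fun j _ => hw0 _
  have hmin0 : ∀ c : ι → β, 0 ≤ min 1 (a * hits T c) := fun c => by positivity
  have hfac : (1 : ℝ) ≤ L.factorial := by exact_mod_cast L.factorial_pos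
  rcases le_total (a * max 1 lam) 1 with h | h
  · rw [min_eq_right h]
    calc _ ≤ ∑ c : ι → β, (a * max 1 lam) ^ L *
            ((∏ j, w (c j)) * ((hits T c : ℝ) / max 1 lam) ^ L) := by
          refine Finset.sum_le_sum fun c _ => ?_
          have h1 : min 1 (a * hits T c) ≤ (a * max 1 lam) * ((hits T c : ℝ) / max 1 lam) := by
            refine (min_le_right _ _).trans (le_of_eq ?_)
            field_simp
          calc _ ≤ (∏ j, w (c j)) * ((a * max 1 lam) * ((hits T c : ℝ) / max 1 lam)) ^ L :=
                mul_le_mul_of_nonneg_left (pow_le_pow_left₀ (hmin0 c) h1 L) (hprod c)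
            _ = _ := by rw [mul_pow]; ring
      _ = (a * max 1 lam) ^ L *
            ∑ c : ι → β, ((∏ j, w (c j)) * ((hits T c : ℝ) / max 1 lam) ^ L) := by
          rw [Finset.mul_sum]
      _ ≤ (a * max 1 lam) ^ L * (16 * L.factorial * min 1 lam) := by gcongr
      _ = _ := by ring
  · rw [min_eq_left h, one_pow, mul_one]
    rcases le_total lam 1 with h1 | h1
    · rw [max_eq_left h1] at hmom
      refine le_trans (Finset.sum_le_sum fun c _ => mul_le_mul_of_nonneg_left
        (pow_le_pow_left₀ (hmin0 c) ?_ L) (hprod c)) hmom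
      rcases Nat.eq_zero_or_pos (hits T c) with h2 | h2
      · simp [h2]
      · rw [div_one]
        exact (min_le_left _ _).trans (by exact_mod_cast h2)
    · rw [min_eq_left h1, mul_one]
      calc _ ≤ ∑ c : ι → β, (∏ j, w (c j)) := by
            refine Finset.sum_le_sum fun c _ => mul_le_of_le_one_right (hprod c) ?_
            exact pow_le_one₀ (hmin0 c) (min_le_left _ _)
        _ = 1 := sum_prod_eq_one hw
        _ ≤ _ := by linarith

/-- A Chernoff lower tail: restrict to `N > λ / 4`. Since `N` is an integer, this event forces `N ≥
1` as well, hence `N ≥ max 1 λ / 4`, so small and large means are treated together. -/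
theorem le_sum_prod_mul_min_hits_pow (L : ℕ) {a : ℝ} (ha : 0 ≤ a) :
    (min 1 (Fintype.card ι * p) * (min 1 (a * max 1 (Fintype.card ι * p))) ^ L) / (8 * 4 ^ L) ≤
    ∑ c : ι → β, (∏ j, w (c j)) * (min 1 (a * hits T c)) ^ L := by
  have hp0 : 0 ≤ p := by
    rw [hp]; exact Finset.sum_nonneg fun b _ => by split_ifs <;> simp [hw0]
  have hmgf := sum_prod_mul_exp_hits_le (ι := ι) hw0 hw hp (-1)
  set lam : ℝ := Fintype.card ι * p with hlam
  have hl0 : 0 ≤ lam := by positivity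
  have hprod : ∀ c : ι → β, 0 ≤ ∏ j, w (c j) := fun c => Finset.prod_nonneg fun j _ => hw0 _
  set B : ℝ := (min 1 (a * max 1 lam) / 4) ^ L with hB
  have hb0 : 0 ≤ min 1 (a * max 1 lam) := by positivity
  have hB0 : 0 ≤ B := by positivity
  -- `1 - exp (λ / 4 - N)` is a lower bound for the indicator of `N > λ / 4`, being nonpositive off
  -- that event and at most 1 on it.
  have hpt : ∀ c : ι → β,
      B * (1 - Real.exp (lam / 4) * Real.exp (-1 * hits T c)) ≤ (min 1 (a * hits T c)) ^ L := by
    intro c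
    have hr0 : 0 ≤ (min 1 (a * hits T c)) ^ L := by positivity
    rw [← Real.exp_add]
    rcases le_or_gt (hits T c : ℝ) (lam / 4) with h | h
    · have : 1 ≤ Real.exp (lam / 4 + -1 * hits T c) := Real.one_le_exp (by linarith)
      nlinarith
    · have h1 : (1 : ℝ) ≤ hits T c := by
        have : 0 < (hits T c : ℝ) := by linarith
        exact_mod_cast this
      have h2 : max 1 lam / 4 ≤ hits T c := by
        rcases le_total 1 lam with h3 | h3
        · rw [max_eq_right h3]; exact h.le
        · rw [max_eq_left h3]; linarith
      have h3 : min 1 (a * max 1 lam) / 4 ≤ min 1 (a * hits T c) := by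
        refine le_min ?_ ?_
        · have := min_le_left 1 (a * max 1 lam); linarith
        · have := min_le_right 1 (a * max 1 lam)
          have := mul_le_mul_of_nonneg_left h2 ha
          linarith
      calc _ ≤ B := mul_le_of_le_one_right hB0 (by linarith [Real.exp_pos (lam / 4 + -1 * hits T c)])
        _ ≤ _ := pow_le_pow_left₀ (by positivity) h3 L
  -- Since `exp (-1) ≤ 1 / 2`, the total exponent is at most `-λ / 4`.
  have hE : min 1 lam / 8 ≤ 1 - Real.exp (lam / 4) * Real.exp (lam * (Real.exp (-1) - 1)) := by
    rw [← Real.exp_add]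
    have h1 : Real.exp (-1) ≤ 1 / 2 := by
      rw [Real.exp_neg, one_div]
      exact inv_anti₀ (by norm_num) (by linarith [Real.add_one_le_exp (1 : ℝ)])
    have h2 : Real.exp (lam / 4 + lam * (Real.exp (-1) - 1)) ≤ Real.exp (-(lam / 4)) :=
      Real.exp_le_exp.2 (by nlinarith)
    have h3 : Real.exp (-(lam / 4)) ≤ (1 + lam / 4)⁻¹ := by
      rw [Real.exp_neg]
      exact inv_anti₀ (by positivity) (by linarith [Real.add_one_le_exp (lam / 4)])
    have h4 : min 1 lam / 8 ≤ 1 - (1 + lam / 4)⁻¹ := by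
      have : 1 - (1 + lam / 4)⁻¹ = lam / (4 + lam) := by field_simp; ring
      rw [this, le_div_iff₀ (by positivity)]
      rcases le_total 1 lam with h3 | h3
      · rw [min_eq_left h3]; linarith
      · rw [min_eq_right h3]; nlinarith
    linarith
  calc _ = B * (min 1 lam / 8) := by rw [hB, div_pow]; field_simp
    _ ≤ B * (1 - Real.exp (lam / 4) * Real.exp (lam * (Real.exp (-1) - 1))) := by gcongr
    _ ≤ B * (1 - Real.exp (lam / 4) *
          ∑ c : ι → β, (∏ j, w (c j)) * Real.exp (-1 * hits T c)) := by gcongr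
    _ = ∑ c : ι → β, (∏ j, w (c j)) *
          (B * (1 - Real.exp (lam / 4) * Real.exp (-1 * hits T c))) := by
        have h : ∑ c : ι → β, (∏ j, w (c j)) *
            (B * (1 - Real.exp (lam / 4) * Real.exp (-1 * hits T c))) =
            B * (∑ c : ι → β, (∏ j, w (c j)) - Real.exp (lam / 4) *
              ∑ c : ι → β, (∏ j, w (c j)) * Real.exp (-1 * hits T c)) := by
          rw [Finset.mul_sum, ← Finset.sum_sub_distrib, Finset.mul_sum]
          exact Finset.sum_congr rfl fun c _ => by ring
        rw [h, sum_prod_eq_one hw]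
    _ ≤ _ := Finset.sum_le_sum fun c _ => mul_le_mul_of_nonneg_left (hpt c) (hprod c)

end ProductLaw

end ListDecoding

end

/-! ### Joint types, the law of a random codeword, and the channel law. -/

noncomputable section

namespace ListDecoding

section JointTypes

variable {X Y : Type*} [Fintype X] [DecidableEq X] [Fintype Y] [DecidableEq Y] {n : ℕ}

omit [Fintype X] in
theorem marginalX_empiricalDist (z : Fin n → X × Y) :
    marginalX (empiricalDist z) = empiricalDist fun i => (z i).1 := by
  funext x
  unfold marginalX empiricalDist
  rw [← Finset.sum_div]
  congr 1
  norm_cast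
  rw [Finset.card_eq_sum_card_fiberwise (t := Finset.univ) (f := fun i => (z i).2) (by simp)]
  refine Finset.sum_congr rfl fun y _ => ?_
  rw [Finset.filter_filter]
  congr 1
  ext i
  simp [Prod.ext_iff]

omit [Fintype Y] in
theorem marginalY_empiricalDist (z : Fin n → X × Y) :
    marginalY (empiricalDist z) = empiricalDist fun i => (z i).2 := by
  funext y
  unfold marginalY empiricalDist
  rw [← Finset.sum_div]
  congr 1
  norm_cast
  rw [Finset.card_eq_sum_card_fiberwise (t := Finset.univ) (f := fun i => (z i).1) (by simp)]
  refine Finset.sum_congr rfl fun x _ => ?_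
  rw [Finset.filter_filter]
  congr 1
  ext i
  simp [Prod.ext_iff, and_comm]

open Classical in
-- Project the joint type class to its `Y`-sequences. These all have the same type, so a permutation
-- of the coordinates carries any fibre onto any other, and all fibres have equal size.
theorem card_conditional_typeClass_mul (z : Fin n → X × Y) {y : Fin n → Y}
    (hy : empiricalDist y = marginalY (empiricalDist z)) :
    (Finset.univ.filter fun x : Fin n → X =>
        empiricalDist (fun i => (x i, y i)) = empiricalDist z).card *
      (typeClass n (marginalY (empiricalDist z))).card =
      (typeClass n (empiricalDist z)).card := by
  have h1 := Finset.card_eq_sum_card_fiberwise (s := typeClass n (empiricalDist z))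
    (t := typeClass n (marginalY (empiricalDist z))) (f := fun w i => (w i).2)
    (fun w hw => by
      have := mem_typeClass.1 hw
      refine mem_typeClass.2 ?_
      rw [← this, marginalY_empiricalDist])
  rw [h1, mul_comm, ← smul_eq_mul, ← Finset.sum_const]
  refine Finset.sum_congr rfl fun y' hy' => ?_
  obtain ⟨σ, hσ⟩ := exists_perm_of_empiricalDist_eq ((mem_typeClass.1 hy').trans hy.symm)
  apply Finset.card_bij (fun x _ i => (x (σ i), y' i))
  · intro x hx
    simp only [Finset.mem_filter, Finset.mem_univ, true_and] at hx
    simp only [Finset.mem_filter, mem_typeClass, and_true]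
    rw [← hx, ← empiricalDist_comp_perm (fun i => (x i, y i)) σ, ← hσ]
    rfl
  · intro x _ x' _ h
    funext i
    have := congrArg Prod.fst (congrFun h (σ.symm i))
    simpa using this
  · intro w hw
    simp only [Finset.mem_filter, mem_typeClass] at hw
    refine ⟨fun i => (w (σ.symm i)).1, ?_, ?_⟩
    · simp only [Finset.mem_filter, Finset.mem_univ, true_and]
      rw [← hw.1, ← empiricalDist_comp_perm w σ.symm]
      congr 1
      funext i
      refine Prod.ext rfl ?_
      have h2 := congrFun hw.2 (σ.symm i)
      have h3 := congrFun hσ (σ.symm i)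
      simp only [Function.comp_apply, Equiv.apply_symm_apply] at h2 h3 ⊢
      rw [h2, h3]
    · funext i
      refine Prod.ext (by simp) ?_
      exact (congrFun hw.2 i).symm

end JointTypes

section CodewordLaw

variable {X Y : Type*} [Fintype X] [DecidableEq X] [Fintype Y] [DecidableEq Y] {n : ℕ}

theorem codewordProb_nonneg (q : X → ℝ) (x : Fin n → X) : 0 ≤ codewordProb q x := by
  unfold codewordProb; split_ifs <;> positivity

theorem sum_codewordProb {q : X → ℝ} (hq : q ∈ types X n) :
    ∑ x : Fin n → X, codewordProb q x = 1 := by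
  obtain ⟨z, rfl⟩ := hq
  have := card_typeClass_pos z
  unfold codewordProb
  rw [← Finset.sum_filter, Finset.filter_mem_eq_inter, Finset.univ_inter, Finset.sum_const,
    nsmul_eq_mul]
  field_simp

open Classical in
/-- Probability that a random codeword has joint type `P` with a fixed sequence of type `P_Y`. -/
theorem sum_codewordProb_jointType {P : X × Y → ℝ} (hP : P ∈ types (X × Y) n)
    {y : Fin n → Y} (hy : empiricalDist y = marginalY P) :
    ∑ x : Fin n → X, (if empiricalDist (fun i => (x i, y i)) = P
        then codewordProb (marginalX P) x else 0) =
      (typeClass n P).card /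
        ((typeClass n (marginalX P)).card * (typeClass n (marginalY P)).card : ℝ) := by
  obtain ⟨z, rfl⟩ := hP
  have hc := card_conditional_typeClass_mul z hy
  have hpos : 0 < (typeClass n (marginalY (empiricalDist z))).card := by
    rw [marginalY_empiricalDist]; exact card_typeClass_pos _
  have hposX : 0 < (typeClass n (marginalX (empiricalDist z))).card := by
    rw [marginalX_empiricalDist]; exact card_typeClass_pos _
  have h1 : ∀ x : Fin n → X, (if empiricalDist (fun i => (x i, y i)) = empiricalDist z
        then codewordProb (marginalX (empiricalDist z)) x else 0) =
      if empiricalDist (fun i => (x i, y i)) = empiricalDist z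
        then 1 / ((typeClass n (marginalX (empiricalDist z))).card : ℝ) else 0 := by
    intro x
    split_ifs with h
    · unfold codewordProb
      rw [if_pos]
      rw [mem_typeClass, ← h, marginalX_empiricalDist]
    · rfl
  rw [Finset.sum_congr rfl fun x _ => h1 x, ← Finset.sum_filter, Finset.sum_const, nsmul_eq_mul,
    ← hc]
  push_cast
  field_simp

theorem sum_comp_eq_mul_sum_empiricalDist {α : Type*} [Fintype α] [DecidableEq α]
    (z : Fin n → α) (f : α → ℝ) :
    ∑ i, f (z i) = n * ∑ a, empiricalDist z a * f a := by
  rw [Finset.mul_sum, ← Finset.sum_fiberwise Finset.univ z]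
  refine Finset.sum_congr rfl fun a _ => ?_
  rw [← mul_assoc, natCast_mul_empiricalDist, ← nsmul_eq_mul, ← Finset.sum_const]
  refine Finset.sum_congr rfl fun i hi => ?_
  rw [(Finset.mem_filter.1 hi).2]

theorem empiricalDist_eq_zero_iff {α : Type*} [DecidableEq α] (z : Fin n → α) (a : α) :
    empiricalDist z a = 0 ↔ ∀ i, z i ≠ a := by
  unfold empiricalDist
  rcases Nat.eq_zero_or_pos n with rfl | hn
  · simp
  · have : (n : ℝ) ≠ 0 := by positivity
    simp [this, Finset.filter_eq_empty_iff]

/-- The support hypothesis is essential: `Real.log 0 = 0`, so the right-hand side would not detect a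
forbidden transition. -/
theorem channelProb_eq_exp {W : X → Y → ℝ} (hW : ∀ x y, 0 ≤ W x y) {z : Fin n → X × Y}
    (hz : ∀ x y, W x y = 0 → empiricalDist z (x, y) = 0) :
    channelProb W (fun i => (z i).1) (fun i => (z i).2) =
      Real.exp (n * ∑ a, empiricalDist z a * Real.log (W a.1 a.2)) := by
  rw [← sum_comp_eq_mul_sum_empiricalDist z (fun a => Real.log (W a.1 a.2)), Real.exp_sum]
  refine Finset.prod_congr rfl fun i _ => ?_
  have : W (z i).1 (z i).2 ≠ 0 := fun h =>
    (empiricalDist_eq_zero_iff z _).1 (hz _ _ h) i rfl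
  rw [Real.exp_log (lt_of_le_of_ne (hW _ _) this.symm)]

omit [Fintype X] [Fintype Y] in
theorem channelProb_eq_zero {W : X → Y → ℝ} {z : Fin n → X × Y}
    (hz : ¬ ∀ x y, W x y = 0 → empiricalDist z (x, y) = 0) :
    channelProb W (fun i => (z i).1) (fun i => (z i).2) = 0 := by
  push Not at hz
  obtain ⟨x, y, h, h'⟩ := hz
  rw [Ne, empiricalDist_eq_zero_iff] at h'
  push Not at h'
  obtain ⟨i, hi⟩ := h'
  exact Finset.prod_eq_zero (Finset.mem_univ i) (by simpa [hi] using h)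

end CodewordLaw

end ListDecoding

end

/-! ### Miss probability for a given sent codeword and output. -/

noncomputable section

namespace ListDecoding

theorem min_one_sum_le {ι : Type*} (s : Finset ι) {b : ι → ℝ} (hb : ∀ i, 0 ≤ b i) :
    min 1 (∑ i ∈ s, b i) ≤ ∑ i ∈ s, min 1 (b i) := by
  have h0 : ∀ i, 0 ≤ min 1 (b i) := fun i => le_min zero_le_one (hb i)
  by_cases h : ∃ i ∈ s, 1 ≤ b i
  · obtain ⟨i, hi, h1⟩ := h
    refine (min_le_left _ _).trans ?_
    refine le_trans (le_min le_rfl h1) ?_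
    exact Finset.single_le_sum (f := fun i => min 1 (b i)) (fun j _ => h0 j) hi
  · push Not at h
    refine (min_le_right _ _).trans (Finset.sum_le_sum fun i hi => ?_)
    rw [min_eq_right (h i hi).le]

/-- Separates the competing joint types at polynomial cost: truncation at 1 is subadditive, and the
power mean inequality moves the exponent inside the sum. -/
theorem min_one_sum_pow_le {ι : Type*} (s : Finset ι) {b : ι → ℝ} (hb : ∀ i, 0 ≤ b i) (L : ℕ)
    (hL : 1 ≤ L) :
    (min 1 (∑ i ∈ s, b i)) ^ L ≤ (s.card : ℝ) ^ L * ∑ i ∈ s, (min 1 (b i)) ^ L := by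
  have h0 : ∀ i, 0 ≤ min 1 (b i) := fun i => le_min zero_le_one (hb i)
  have hs : 0 ≤ ∑ i ∈ s, b i := Finset.sum_nonneg fun i _ => hb i
  rcases s.eq_empty_or_nonempty with rfl | hne
  · simp [zero_pow (Nat.one_le_iff_ne_zero.1 hL)]
  obtain ⟨k, rfl⟩ : ∃ k, L = k + 1 := ⟨L - 1, by omega⟩
  have h1 := pow_sum_div_card_le_sum_pow (s := s) (f := fun i => min 1 (b i)) (fun i _ => h0 i) k
  have hc : (1 : ℝ) ≤ s.card := by exact_mod_cast hne.card_pos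
  rw [div_le_iff₀' (by positivity)] at h1
  have h2 : 0 ≤ ∑ i ∈ s, (min 1 (b i)) ^ (k + 1) :=
    Finset.sum_nonneg fun i _ => pow_nonneg (h0 i) _
  calc _ ≤ (∑ i ∈ s, min 1 (b i)) ^ (k + 1) :=
        pow_le_pow_left₀ (le_min zero_le_one hs) (min_one_sum_le s hb) _
    _ ≤ _ := h1
    _ ≤ _ := by
      gcongr
      exact k.le_succ

section Decoder

variable {X Y : Type*} [Fintype X] [DecidableEq X] [Fintype Y] [DecidableEq Y] {n : ℕ}

omit [Fintype X] [Fintype Y] in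
theorem metric_pos (g : (X × Y → ℝ) → ℝ) (x : Fin n → X) (y : Fin n → Y) : 0 < metric g x y :=
  Real.exp_pos _

omit [Fintype X] [Fintype Y] in
-- The lists avoiding `m` form a product set, so the sum factors into L equal single-draw
-- probabilities.
theorem listErrorProb_eq {M : ℕ} (g : (X × Y → ℝ) → ℝ) (L : ℕ) (c : Fin M → Fin n → X)
    (y : Fin n → Y) (m : Fin M) :
    listErrorProb g L c y m =
      ((∑ j : {j // j ≠ m}, metric g (c j) y) /
        (metric g (c m) y + ∑ j : {j // j ≠ m}, metric g (c j) y)) ^ L := by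
  have h := Finset.prod_univ_sum (fun _ : Fin L => Finset.univ.filter fun j : Fin M => j ≠ m)
    (fun _ j => decodeProb g c y j)
  rw [Finset.prod_const, Finset.card_univ, Fintype.card_fin] at h
  have hset : (Finset.univ.filter fun l : Fin L → Fin M => ∀ i, l i ≠ m) =
      Fintype.piFinset fun _ : Fin L => Finset.univ.filter fun j : Fin M => j ≠ m := by
    ext l; simp [Fintype.mem_piFinset]
  have hsub : ∑ j : {j // j ≠ m}, metric g (c j) y =
      ∑ j ∈ Finset.univ.filter (fun j : Fin M => j ≠ m), metric g (c j) y :=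
    (Finset.sum_subtype _ (by simp) fun j => metric g (c j) y).symm
  have htot : ∑ j, metric g (c j) y =
      metric g (c m) y + ∑ j : {j // j ≠ m}, metric g (c j) y := by
    rw [hsub, ← Finset.add_sum_erase _ _ (Finset.mem_univ m)]
    congr 2
    ext j; simp
  unfold listErrorProb
  rw [hset, ← h, ← htot, hsub, Finset.sum_div]
  rfl

/-- Probability that the list misses a message with codeword `x` when `y` is received and the
other codewords, indexed by `ι`, are random. -/
def missProb (ι : Type*) [Fintype ι] [DecidableEq ι] (g : (X × Y → ℝ) → ℝ) (q : X → ℝ) (L : ℕ)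
    (x : Fin n → X) (y : Fin n → Y) : ℝ :=
  ∑ c : ι → Fin n → X, (∏ j, codewordProb q (c j)) *
    ((∑ j, metric g (c j) y) / (metric g x y + ∑ j, metric g (c j) y)) ^ L

/-- Independence of the codewords: the sent one is split off and merged with the output into one
sequence of pairs `z`, whose joint type then governs everything. -/
theorem avgErrorProb_eq (W : X → Y → ℝ) (g : (X × Y → ℝ) → ℝ) (q : X → ℝ) (M L n : ℕ) :
    avgErrorProb W g q M L n = (1 / (M : ℝ)) * ∑ m : Fin M, ∑ z : Fin n → X × Y,
      codewordProb q (fun i => (z i).1) *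
        channelProb W (fun i => (z i).1) (fun i => (z i).2) *
        missProb {j : Fin M // j ≠ m} g q L (fun i => (z i).1) (fun i => (z i).2) := by
  have h1 : avgErrorProb W g q M L n = (1 / (M : ℝ)) * ∑ m : Fin M,
      ∑ c : Fin M → Fin n → X, (∏ j, codewordProb q (c j)) *
        ∑ y : Fin n → Y, channelProb W (c m) y * listErrorProb g L c y m := by
    unfold avgErrorProb
    rw [Finset.sum_comm, Finset.mul_sum]
    refine Finset.sum_congr rfl fun c _ => ?_
    rw [← Finset.mul_sum]
    ring
  rw [h1]
  congr 1
  refine Finset.sum_congr rfl fun m _ => ?_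
  rw [← (Equiv.funSplitAt m (Fin n → X)).symm.sum_comp, Fintype.sum_prod_type,
    ← (Equiv.arrowProdEquivProdArrow (Fin n) (fun _ => X) (fun _ => Y)).symm.sum_comp,
    Fintype.sum_prod_type]
  refine Finset.sum_congr rfl fun x _ => ?_
  simp_rw [Finset.mul_sum]
  rw [Finset.sum_comm]
  refine Finset.sum_congr rfl fun y _ => ?_
  simp only [missProb, Finset.mul_sum]
  refine Finset.sum_congr rfl fun c _ => ?_
  have hm : (Equiv.funSplitAt m (Fin n → X)).symm (x, c) m = x := by
    simp [Equiv.funSplitAt, Equiv.piSplitAt]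
  have hj : ∀ j : {j // j ≠ m}, (Equiv.funSplitAt m (Fin n → X)).symm (x, c) j = c j := by
    intro j
    simp [Equiv.funSplitAt, Equiv.piSplitAt, j.2]
  have hprod : ∏ j, codewordProb q ((Equiv.funSplitAt m (Fin n → X)).symm (x, c) j) =
      codewordProb q x * ∏ j, codewordProb q (c j) := by
    rw [← Finset.mul_prod_erase _ _ (Finset.mem_univ m), hm]
    congr 1
    rw [Finset.prod_subtype (p := fun j => j ≠ m) _ (by simp)
      fun j => codewordProb q ((Equiv.funSplitAt m (Fin n → X)).symm (x, c) j)]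
    exact Finset.prod_congr rfl fun j _ => by rw [hj]
  rw [listErrorProb_eq, hprod, hm]
  simp_rw [hj]
  change _ = _ * (_ * _)
  simp only [Equiv.arrowProdEquivProdArrow_symm_apply]
  ring

/-- Contribution to the miss probability of `k` competing codewords, each of which has the
dominant joint type with probability `p` and metric ratio `a`. -/
def missTerm (L k : ℕ) (a p : ℝ) : ℝ :=
  min 1 (k * p) * (min 1 (a * max 1 (k * p))) ^ L

theorem missTerm_zero (L k : ℕ) (a : ℝ) : missTerm L k a 0 = 0 := by
  simp [missTerm]

variable {ι : Type*} [Fintype ι] [DecidableEq ι]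

open Classical in
/-- Probability that a random codeword has joint type `P'` with `y`. -/
def jointTypeProb (q : X → ℝ) (y : Fin n → Y) (P' : X × Y → ℝ) : ℝ :=
  ∑ x : Fin n → X, if empiricalDist (fun i => (x i, y i)) = P' then codewordProb q x else 0

open Classical in
-- Uses `S / (u + S) ≤ min 1 (S / u)`, sorts the competitors by joint type, and applies the binomial
-- bound to each type.
theorem missProb_le {g : (X × Y → ℝ) → ℝ} {q : X → ℝ} (hq : q ∈ types X n) {L : ℕ} (hL : 1 ≤ L)
    (x : Fin n → X) (y : Fin n → Y) :
    missProb ι g q L x y ≤ ((typeFinset (X × Y) n).card : ℝ) ^ L *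
      ∑ P' ∈ typeFinset (X × Y) n, 16 * L.factorial *
        missTerm L (Fintype.card ι)
          (Real.exp (n * (g P' - g (empiricalDist fun i => (x i, y i))))) (jointTypeProb q y P') := by
  set P := empiricalDist fun i => (x i, y i) with hP
  set T : (X × Y → ℝ) → (Fin n → X) → Prop :=
    fun P' x' => empiricalDist (fun i => (x' i, y i)) = P' with hT
  have hprod : ∀ c : ι → Fin n → X, 0 ≤ ∏ j, codewordProb q (c j) := fun c =>
    Finset.prod_nonneg fun j _ => codewordProb_nonneg q _
  have hpt : ∀ c : ι → Fin n → X,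
      ((∑ j, metric g (c j) y) / (metric g x y + ∑ j, metric g (c j) y)) ^ L ≤
      ((typeFinset (X × Y) n).card : ℝ) ^ L * ∑ P' ∈ typeFinset (X × Y) n,
        (min 1 (Real.exp (n * (g P' - g P)) * hits (T P') c)) ^ L := by
    intro c
    have hS : 0 ≤ ∑ j, metric g (c j) y := Finset.sum_nonneg fun j _ => (metric_pos _ _ _).le
    have hu := metric_pos g x y
    have hsum : (∑ j, metric g (c j) y) / metric g x y =
        ∑ P' ∈ typeFinset (X × Y) n, Real.exp (n * (g P' - g P)) * hits (T P') c := by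
      have : ∀ j ∈ Finset.univ, empiricalDist (fun i => (c j i, y i)) ∈ typeFinset (X × Y) n :=
        fun j _ => mem_typeFinset.2 ⟨_, rfl⟩
      rw [Finset.sum_div, ← Finset.sum_fiberwise_of_maps_to this]
      refine Finset.sum_congr rfl fun P' _ => ?_
      rw [mul_comm, hits, ← nsmul_eq_mul, ← Finset.sum_const]
      refine Finset.sum_congr rfl fun j hj => ?_
      rw [metric, metric, ← Real.exp_sub, (Finset.mem_filter.1 hj).2, ← hP]
      congr 1
      ring
    refine le_trans (pow_le_pow_left₀ (div_nonneg hS (add_nonneg hu.le hS)) ?_ L)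
      (min_one_sum_pow_le _ (b := fun P' => Real.exp (n * (g P' - g P)) * hits (T P') c)
        (fun P' => mul_nonneg (Real.exp_pos _).le (Nat.cast_nonneg _)) L hL)
    rw [← hsum]
    refine le_min (div_le_one_of_le₀ (by linarith) (add_nonneg hu.le hS)) ?_
    exact div_le_div_of_nonneg_left hS hu (by linarith)
  calc missProb ι g q L x y
      ≤ ∑ c : ι → Fin n → X, (∏ j, codewordProb q (c j)) *
          (((typeFinset (X × Y) n).card : ℝ) ^ L * ∑ P' ∈ typeFinset (X × Y) n,
            (min 1 (Real.exp (n * (g P' - g P)) * hits (T P') c)) ^ L) :=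
        Finset.sum_le_sum fun c _ => mul_le_mul_of_nonneg_left (hpt c) (hprod c)
    _ = ((typeFinset (X × Y) n).card : ℝ) ^ L * ∑ P' ∈ typeFinset (X × Y) n,
          ∑ c : ι → Fin n → X, (∏ j, codewordProb q (c j)) *
            (min 1 (Real.exp (n * (g P' - g P)) * hits (T P') c)) ^ L := by
        rw [Finset.sum_comm, Finset.mul_sum]
        refine Finset.sum_congr rfl fun c _ => ?_
        rw [← Finset.mul_sum]
        ring
    _ ≤ _ := by
        refine mul_le_mul_of_nonneg_left (Finset.sum_le_sum fun P' _ => ?_)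
          (pow_nonneg (Nat.cast_nonneg _) _)
        exact sum_prod_mul_min_hits_pow_le (T := T P') (codewordProb_nonneg q)
          (sum_codewordProb hq) rfl hL (Real.exp_pos _).le

open Classical in
-- Keeps only the competitors of joint type `P'`. The inequality `min 1 r / 2 ≤ S / (u + S)` for `S
-- ≥ u r` costs `2 ^ L`, on top of the `4 ^ L` of the binomial bound.
theorem le_missProb {g : (X × Y → ℝ) → ℝ} {q : X → ℝ} (hq : q ∈ types X n) (L : ℕ)
    (x : Fin n → X) (y : Fin n → Y) (P' : X × Y → ℝ) :
    missTerm L (Fintype.card ι)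
        (Real.exp (n * (g P' - g (empiricalDist fun i => (x i, y i))))) (jointTypeProb q y P') /
      (8 * 8 ^ L) ≤ missProb ι g q L x y := by
  set P := empiricalDist fun i => (x i, y i) with hP
  set T : (X × Y → ℝ) → (Fin n → X) → Prop :=
    fun P' x' => empiricalDist (fun i => (x' i, y i)) = P' with hT
  have hprod : ∀ c : ι → Fin n → X, 0 ≤ ∏ j, codewordProb q (c j) := fun c =>
    Finset.prod_nonneg fun j _ => codewordProb_nonneg q _
  have hpt : ∀ c : ι → Fin n → X,
      (min 1 (Real.exp (n * (g P' - g P)) * hits (T P') c)) ^ L / 2 ^ L ≤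
      ((∑ j, metric g (c j) y) / (metric g x y + ∑ j, metric g (c j) y)) ^ L := by
    intro c
    have hu := metric_pos g x y
    have hr0 : 0 ≤ Real.exp (n * (g P' - g P)) * hits (T P') c :=
      mul_nonneg (Real.exp_pos _).le (Nat.cast_nonneg _)
    have hsum : metric g x y * (Real.exp (n * (g P' - g P)) * hits (T P') c) ≤
        ∑ j, metric g (c j) y := by
      have h1 : metric g x y * (Real.exp (n * (g P' - g P)) * hits (T P') c) =
          ∑ j ∈ Finset.univ.filter (fun j => T P' (c j)), metric g (c j) y := by
        rw [← mul_assoc, mul_comm, hits, ← nsmul_eq_mul, ← Finset.sum_const]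
        refine Finset.sum_congr rfl fun j hj => ?_
        have hj' : empiricalDist (fun i => (c j i, y i)) = P' := (Finset.mem_filter.1 hj).2
        rw [metric, metric, hj', ← hP, ← Real.exp_add]
        congr 1
        ring
      rw [h1]
      exact Finset.sum_le_sum_of_subset_of_nonneg (Finset.filter_subset _ _)
        fun j _ _ => (metric_pos _ _ _).le
    generalize ∑ j, metric g (c j) y = S at hsum ⊢
    generalize Real.exp (n * (g P' - g P)) * hits (T P') c = r at hsum hr0 ⊢
    generalize metric g x y = u at hsum hu ⊢
    have hS : 0 ≤ S := le_trans (by positivity) hsum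
    rw [← div_pow]
    refine pow_le_pow_left₀ (by positivity) ?_ L
    rw [div_le_div_iff₀ (by norm_num) (by positivity)]
    have hm1 : min 1 r ≤ 1 := min_le_left _ _
    have hmr : min 1 r ≤ r := min_le_right _ _
    have hm0 : 0 ≤ min 1 r := le_min zero_le_one hr0
    nlinarith
  have hmain := le_sum_prod_mul_min_hits_pow (ι := ι) (T := T P') (codewordProb_nonneg q)
    (sum_codewordProb hq) (p := jointTypeProb q y P') rfl L
    (Real.exp_pos (n * (g P' - g P))).le
  calc _ = missTerm L (Fintype.card ι) (Real.exp (n * (g P' - g P))) (jointTypeProb q y P') /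
        (8 * 4 ^ L) / 2 ^ L := by
        rw [div_div, mul_assoc, ← mul_pow]; norm_num
    _ ≤ (∑ c : ι → Fin n → X, (∏ j, codewordProb q (c j)) *
          (min 1 (Real.exp (n * (g P' - g P)) * hits (T P') c)) ^ L) / 2 ^ L := by
        gcongr
        exact hmain
    _ = ∑ c : ι → Fin n → X, (∏ j, codewordProb q (c j)) *
          ((min 1 (Real.exp (n * (g P' - g P)) * hits (T P') c)) ^ L / 2 ^ L) := by
        rw [Finset.sum_div]
        exact Finset.sum_congr rfl fun c _ => by rw [mul_div_assoc]
    _ ≤ _ := Finset.sum_le_sum fun c _ => mul_le_mul_of_nonneg_left (hpt c) (hprod c)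

end Decoder

end ListDecoding

end

/-! ### Reduction of the average error to pairs of joint types. -/

noncomputable section

namespace ListDecoding

variable {X Y : Type*} [Fintype X] [DecidableEq X] [Fintype Y] [DecidableEq Y] {n : ℕ}

/-- Pairs of joint types that the sent and a competing codeword can have with the output. -/
structure FeasibleTypes (W : X → Y → ℝ) (q : X → ℝ) (n : ℕ) (P P' : X × Y → ℝ) : Prop where
  fst_mem : P ∈ types (X × Y) n
  snd_mem : P' ∈ types (X × Y) n
  fst_marginalX : marginalX P = q
  snd_marginalX : marginalX P' = q
  marginalY_eq : marginalY P' = marginalY P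
  eq_zero : ∀ x y, W x y = 0 → P (x, y) = 0

/-- Contribution of the pair of joint types `(P, P')` to the average error probability. -/
def pairTerm (W : X → Y → ℝ) (g : (X × Y → ℝ) → ℝ) (q : X → ℝ) (M L n : ℕ)
    (P P' : X × Y → ℝ) : ℝ :=
  (typeClass n P).card *
    (Real.exp (n * ∑ a, P a * Real.log (W a.1 a.2)) / (typeClass n q).card *
      missTerm L (M - 1) (Real.exp (n * (g P' - g P)))
        ((typeClass n P').card / ((typeClass n q).card * (typeClass n (marginalY P')).card)))

theorem card_subtype_ne {M : ℕ} (m : Fin M) : Fintype.card {j : Fin M // j ≠ m} = M - 1 := by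
  rw [Fintype.card_subtype_compl]; simp

variable {W : X → Y → ℝ} (hW : ∀ x y, 0 ≤ W x y)
include hW

omit [Fintype X] [DecidableEq X] [Fintype Y] [DecidableEq Y] in
theorem channelProb_nonneg (x : Fin n → X) (y : Fin n → Y) : 0 ≤ channelProb W x y :=
  Finset.prod_nonneg fun _ _ => hW _ _

/-- Every factor depends on `z` only through its joint type, so the members of a type class share
its contribution equally. -/
theorem weight_mul_missTerm_eq {g : (X × Y → ℝ) → ℝ} {q : X → ℝ} {M L : ℕ} {P' : X × Y → ℝ}
    (z : Fin n → X × Y) (h : FeasibleTypes W q n (empiricalDist z) P') :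
    codewordProb q (fun i => (z i).1) * channelProb W (fun i => (z i).1) (fun i => (z i).2) *
      missTerm L (M - 1) (Real.exp (n * (g P' - g (empiricalDist z))))
        (jointTypeProb q (fun i => (z i).2) P') =
      pairTerm W g q M L n (empiricalDist z) P' / (typeClass n (empiricalDist z)).card := by
  have h1 : codewordProb q (fun i => (z i).1) = 1 / ((typeClass n q).card : ℝ) := by
    unfold codewordProb
    rw [if_pos]
    rw [mem_typeClass, ← marginalX_empiricalDist, h.fst_marginalX]
  have h2 : jointTypeProb q (fun i => (z i).2) P' =
      (typeClass n P').card / ((typeClass n q).card * (typeClass n (marginalY P')).card) := by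
    have := sum_codewordProb_jointType h.snd_mem (y := fun i => (z i).2)
      (by rw [h.marginalY_eq, marginalY_empiricalDist])
    rw [h.snd_marginalX] at this
    exact this
  have h3 := card_typeClass_pos z
  rw [h1, h2, channelProb_eq_exp hW h.eq_zero, pairTerm]
  field_simp

/-- The power `L + 2` of the number of types collects L from truncating the sum over `P'`, one from
summing over `P'`, and one from summing over the type of `z`. -/
theorem avgErrorProb_le {g : (X × Y → ℝ) → ℝ} {q : X → ℝ} (hq : q ∈ types X n) {M L : ℕ}
    (hL : 1 ≤ L) {B : ℝ} (hB0 : 0 ≤ B)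
    (hB : ∀ P P', FeasibleTypes W q n P P' → pairTerm W g q M L n P P' ≤ B) :
    avgErrorProb W g q M L n ≤
      16 * L.factorial * ((typeFinset (X × Y) n).card : ℝ) ^ (L + 2) * B := by
  classical
  set K : ℝ := ((typeFinset (X × Y) n).card : ℝ) with hK
  -- Either one of the factors vanishes, or nonvanishing of all of them forces the pair of types to
  -- be feasible.
  have hterm : ∀ (z : Fin n → X × Y) (P' : X × Y → ℝ),
      codewordProb q (fun i => (z i).1) * channelProb W (fun i => (z i).1) (fun i => (z i).2) *
        missTerm L (M - 1) (Real.exp (n * (g P' - g (empiricalDist z))))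
        (jointTypeProb q (fun i => (z i).2) P') ≤ B / (typeClass n (empiricalDist z)).card := by
    intro z P'
    have hr : 0 ≤ B / (typeClass n (empiricalDist z)).card := by positivity
    by_cases h1 : codewordProb q (fun i => (z i).1) = 0
    · rw [h1]; simpa using hr
    by_cases h2 : channelProb W (fun i => (z i).1) (fun i => (z i).2) = 0
    · rw [h2]; simpa using hr
    by_cases h3 : jointTypeProb q (fun i => (z i).2) P' = 0
    · rw [h3, missTerm_zero]; simpa using hr
    have hmem : ∀ x : Fin n → X, codewordProb q x ≠ 0 → empiricalDist x = q := by
      intro x hx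
      by_contra h
      exact hx (by rw [codewordProb, if_neg (by rwa [mem_typeClass])])
    obtain ⟨x, -, hx⟩ := Finset.exists_ne_zero_of_sum_ne_zero h3
    have hx1 : empiricalDist (fun i => (x i, (z i).2)) = P' := by
      by_contra h; exact hx (if_neg h)
    rw [if_pos hx1] at hx
    have hf : FeasibleTypes W q n (empiricalDist z) P' :=
      { fst_mem := ⟨z, rfl⟩
        snd_mem := ⟨_, hx1⟩
        fst_marginalX := by rw [marginalX_empiricalDist, hmem _ h1]
        snd_marginalX := by rw [← hx1, marginalX_empiricalDist]; exact hmem _ hx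
        marginalY_eq := by rw [← hx1, marginalY_empiricalDist, marginalY_empiricalDist]
        eq_zero := by by_contra h; exact h2 (channelProb_eq_zero h) }
    rw [weight_mul_missTerm_eq hW z hf]
    exact div_le_div_of_nonneg_right (hB _ _ hf) (Nat.cast_nonneg _)
  have hz : ∀ (m : Fin M) (z : Fin n → X × Y),
      codewordProb q (fun i => (z i).1) * channelProb W (fun i => (z i).1) (fun i => (z i).2) *
        missProb {j : Fin M // j ≠ m} g q L (fun i => (z i).1) (fun i => (z i).2) ≤
      16 * L.factorial * K ^ (L + 1) * B * (1 / (typeClass n (empiricalDist z)).card) := by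
    intro m z
    have hw : 0 ≤ codewordProb q (fun i => (z i).1) *
        channelProb W (fun i => (z i).1) (fun i => (z i).2) :=
      mul_nonneg (codewordProb_nonneg _ _) (channelProb_nonneg hW _ _)
    have h1 := missProb_le (ι := {j : Fin M // j ≠ m}) (g := g) hq hL
      (fun i => (z i).1) (fun i => (z i).2)
    rw [card_subtype_ne] at h1
    refine (mul_le_mul_of_nonneg_left h1 hw).trans ?_
    rw [mul_left_comm, Finset.mul_sum]
    have h2 : ∑ P' ∈ typeFinset (X × Y) n, codewordProb q (fun i => (z i).1) *
        channelProb W (fun i => (z i).1) (fun i => (z i).2) * (16 * L.factorial *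
        missTerm L (M - 1) (Real.exp (n * (g P' - g (empiricalDist z))))
          (jointTypeProb q (fun i => (z i).2) P')) ≤
        ∑ P' ∈ typeFinset (X × Y) n,
          16 * L.factorial * (B / (typeClass n (empiricalDist z)).card) := by
      refine Finset.sum_le_sum fun P' _ => ?_
      rw [mul_left_comm]
      exact mul_le_mul_of_nonneg_left (hterm z P') (by positivity)
    rw [Finset.sum_const, nsmul_eq_mul, ← hK] at h2
    refine (mul_le_mul_of_nonneg_left h2 (pow_nonneg (Nat.cast_nonneg _) _)).trans (le_of_eq ?_)
    rw [pow_succ]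
    ring
  have hsum : ∑ z : Fin n → X × Y, (1 / (typeClass n (empiricalDist z)).card : ℝ) = K := by
    have : ∀ z ∈ (Finset.univ : Finset (Fin n → X × Y)), empiricalDist z ∈ typeFinset (X × Y) n :=
      fun z _ => mem_typeFinset.2 ⟨_, rfl⟩
    rw [← Finset.sum_fiberwise_of_maps_to this, hK, ← nsmul_one, ← Finset.sum_const]
    refine Finset.sum_congr rfl fun P hP => ?_
    obtain ⟨z, rfl⟩ := mem_typeFinset.1 hP
    have hpos := card_typeClass_pos z
    have : ∀ w ∈ Finset.univ.filter (fun w : Fin n → X × Y => empiricalDist w = empiricalDist z),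
        (1 / (typeClass n (empiricalDist w)).card : ℝ) =
          1 / (typeClass n (empiricalDist z)).card := by
      intro w hw
      rw [(Finset.mem_filter.1 hw).2]
    rw [Finset.sum_congr rfl this, Finset.sum_const, nsmul_eq_mul]
    have h2 : Finset.univ.filter (fun w : Fin n → X × Y => empiricalDist w = empiricalDist z) =
        typeClass n (empiricalDist z) := by
      ext w; simp [mem_typeClass]
    rw [h2]
    field_simp
  rw [avgErrorProb_eq]
  have hm : ∀ m : Fin M, ∑ z : Fin n → X × Y,
      codewordProb q (fun i => (z i).1) * channelProb W (fun i => (z i).1) (fun i => (z i).2) *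
        missProb {j : Fin M // j ≠ m} g q L (fun i => (z i).1) (fun i => (z i).2) ≤
      16 * L.factorial * K ^ (L + 2) * B := by
    intro m
    refine (Finset.sum_le_sum fun z _ => hz m z).trans (le_of_eq ?_)
    rw [← Finset.mul_sum, hsum]
    ring
  refine (mul_le_mul_of_nonneg_left (Finset.sum_le_sum fun m _ => hm m) (by positivity)).trans ?_
  rw [Finset.sum_const, Finset.card_univ, Fintype.card_fin, nsmul_eq_mul, ← mul_assoc]
  refine mul_le_of_le_one_left (by positivity) ?_
  rw [one_div]
  exact inv_mul_le_one

theorem le_avgErrorProb {g : (X × Y → ℝ) → ℝ} {q : X → ℝ} (hq : q ∈ types X n) {M : ℕ}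
    (hM : 1 ≤ M) (L : ℕ) {P P' : X × Y → ℝ} (h : FeasibleTypes W q n P P') :
    pairTerm W g q M L n P P' / (8 * 8 ^ L) ≤ avgErrorProb W g q M L n := by
  have hmiss : ∀ (m : Fin M) (z : Fin n → X × Y),
      0 ≤ missProb {j : Fin M // j ≠ m} g q L (fun i => (z i).1) (fun i => (z i).2) := by
    intro m z
    refine Finset.sum_nonneg fun c _ => mul_nonneg
      (Finset.prod_nonneg fun j _ => codewordProb_nonneg q _) (pow_nonneg (div_nonneg ?_ ?_) _)
    · exact Finset.sum_nonneg fun j _ => (metric_pos _ _ _).le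
    · exact add_nonneg (metric_pos _ _ _).le (Finset.sum_nonneg fun j _ => (metric_pos _ _ _).le)
  have hw : ∀ z : Fin n → X × Y, 0 ≤ codewordProb q (fun i => (z i).1) *
      channelProb W (fun i => (z i).1) (fun i => (z i).2) := fun z =>
    mul_nonneg (codewordProb_nonneg _ _) (channelProb_nonneg hW _ _)
  have hm : ∀ m : Fin M, pairTerm W g q M L n P P' / (8 * 8 ^ L) ≤ ∑ z : Fin n → X × Y,
      codewordProb q (fun i => (z i).1) * channelProb W (fun i => (z i).1) (fun i => (z i).2) *
        missProb {j : Fin M // j ≠ m} g q L (fun i => (z i).1) (fun i => (z i).2) := by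
    intro m
    have hpos : 0 < (typeClass n P).card := by
      obtain ⟨z, rfl⟩ := h.fst_mem; exact card_typeClass_pos z
    calc pairTerm W g q M L n P P' / (8 * 8 ^ L)
        = ∑ z ∈ typeClass n P, pairTerm W g q M L n P P' / (typeClass n P).card / (8 * 8 ^ L) := by
          rw [Finset.sum_const, nsmul_eq_mul]
          field_simp
      _ ≤ ∑ z ∈ typeClass n P, codewordProb q (fun i => (z i).1) *
            channelProb W (fun i => (z i).1) (fun i => (z i).2) *
            missProb {j : Fin M // j ≠ m} g q L (fun i => (z i).1) (fun i => (z i).2) := by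
          refine Finset.sum_le_sum fun z hz => ?_
          have hzP := mem_typeClass.1 hz
          have h1 := weight_mul_missTerm_eq hW (g := g) (M := M) (L := L) z (hzP.symm ▸ h)
          have h2 := le_missProb (ι := {j : Fin M // j ≠ m}) (g := g) hq L
            (fun i => (z i).1) (fun i => (z i).2) P'
          rw [card_subtype_ne] at h2
          rw [← hzP, ← h1, mul_div_assoc]
          exact mul_le_mul_of_nonneg_left h2 (hw z)
      _ ≤ _ := Finset.sum_le_sum_of_subset_of_nonneg (Finset.subset_univ _)
          fun z _ _ => mul_nonneg (hw z) (hmiss m z)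
  rw [avgErrorProb_eq]
  calc pairTerm W g q M L n P P' / (8 * 8 ^ L)
      = (1 / (M : ℝ)) * ∑ m : Fin M, pairTerm W g q M L n P P' / (8 * 8 ^ L) := by
        rw [Finset.sum_const, Finset.card_univ, Fintype.card_fin, nsmul_eq_mul]
        have : (M : ℝ) ≠ 0 := by positivity
        field_simp
    _ ≤ _ := mul_le_mul_of_nonneg_left (Finset.sum_le_sum fun m _ => hm m) (by positivity)

end ListDecoding

end

/-! ### Exponential rate of a pair of types. -/

noncomputable section

namespace ListDecoding

theorem min_one_exp {s : ℝ} (hs : 0 ≤ s) (r : ℝ) :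
    min 1 (Real.exp (-(s * r))) = Real.exp (-(s * max r 0)) := by
  rcases le_total 0 r with h | h
  · rw [max_eq_left h, min_eq_right]
    exact Real.exp_le_one_iff.2 (by nlinarith)
  · rw [max_eq_right h, min_eq_left]
    · simp
    · exact Real.one_le_exp (by nlinarith)

theorem max_one_exp {s : ℝ} (hs : 0 ≤ s) (r : ℝ) :
    max 1 (Real.exp (-(s * r))) = Real.exp (s * max (-r) 0) := by
  rcases le_total 0 r with h | h
  · rw [max_eq_right (by linarith : -r ≤ 0), max_eq_left]
    · simp
    · exact Real.exp_le_one_iff.2 (by nlinarith)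
  · rw [max_eq_left (by linarith : (0 : ℝ) ≤ -r), max_eq_right]
    · congr 1; ring
    · exact Real.one_le_exp (by nlinarith)

/-- Rate penalty of a competing joint type of rate deficit `ρ` and metric gap `γ`. -/
def missRate (L : ℕ) (ρ γ : ℝ) : ℝ := max ρ 0 + L * max (γ - max (-ρ) 0) 0

/-- The positive parts of the exponent originate here: truncating an exponential at 1, from above or
below, takes a positive part of its rate. -/
theorem missTerm_eq_exp {s : ℝ} (hs : 0 ≤ s) (L k : ℕ) {p ρ : ℝ} (γ : ℝ)
    (hp : k * p = Real.exp (-(s * ρ))) :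
    missTerm L k (Real.exp (-(s * γ))) p = Real.exp (-(s * missRate L ρ γ)) := by
  unfold missTerm missRate
  rw [hp, min_one_exp hs, max_one_exp hs, ← Real.exp_add,
    show -(s * γ) + s * max (-ρ) 0 = -(s * (γ - max (-ρ) 0)) by ring, min_one_exp hs,
    ← Real.exp_nat_mul, ← Real.exp_add]
  congr 1
  ring

theorem abs_missRate_sub_le (L : ℕ) (ρ σ γ : ℝ) :
    |missRate L ρ γ - missRate L σ γ| ≤ (1 + L) * |ρ - σ| := by
  have h1 : |max ρ 0 - max σ 0| ≤ |ρ - σ| := abs_max_sub_max_le_abs ρ σ 0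
  have h2 : |max (-ρ) 0 - max (-σ) 0| ≤ |ρ - σ| := by
    refine (abs_max_sub_max_le_abs (-ρ) (-σ) 0).trans (le_of_eq ?_)
    rw [← abs_neg]; congr 1; ring
  have h3 : |max (γ - max (-ρ) 0) 0 - max (γ - max (-σ) 0) 0| ≤ |ρ - σ| := by
    refine (abs_max_sub_max_le_abs _ _ 0).trans (le_trans (le_of_eq ?_) h2)
    rw [← abs_neg]; congr 1; ring
  calc |missRate L ρ γ - missRate L σ γ|
      = |(max ρ 0 - max σ 0) + L * (max (γ - max (-ρ) 0) 0 - max (γ - max (-σ) 0) 0)| := by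
        unfold missRate; congr 1; ring
    _ ≤ |max ρ 0 - max σ 0| + |L * (max (γ - max (-ρ) 0) 0 - max (γ - max (-σ) 0) 0)| :=
        abs_add_le _ _
    _ ≤ |ρ - σ| + L * |ρ - σ| := by
        rw [abs_mul, Nat.abs_cast]
        gcongr
    _ = _ := by ring

/-- Mutual information as a combination of entropies. -/
def entropyInfo {X Y : Type*} [Fintype X] [Fintype Y] (P : X × Y → ℝ) : ℝ :=
  entropy (marginalX P) + entropy (marginalY P) - entropy P

/-- Relative entropy of `P` from `P_X × W` as a combination of entropies. -/
def channelDivergence {X Y : Type*} [Fintype X] [Fintype Y] (W : X → Y → ℝ) (P : X × Y → ℝ) : ℝ :=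
  entropy (marginalX P) - entropy P - ∑ a, P a * Real.log (W a.1 a.2)

/-- Real-valued form of the exponent objective. -/
def rateObjective {X Y : Type*} [Fintype X] [Fintype Y] (W : X → Y → ℝ)
    (g : (X × Y → ℝ) → ℝ) (R : ℝ) (L : ℕ) (P P' : X × Y → ℝ) : ℝ :=
  channelDivergence W P + missRate L (entropyInfo P' - R) (g P - g P')

variable {X Y : Type*} [Fintype X] [DecidableEq X] [Fintype Y] [DecidableEq Y] {n : ℕ}

/-- Bound on the distance between the finite-length rate of a pair of types and its limit. -/
def rateErr (X Y : Type*) [Fintype X] [Fintype Y] (R : ℝ) (L M n : ℕ) : ℝ :=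
  (2 + (1 + L) * 3) *
    ((Fintype.card X + Fintype.card Y + Fintype.card (X × Y) + 1) * typeErr n / n) +
  (1 + L) * (Real.log 2 / n + |Real.log M / n - R|)

/-- The divergence involves two type-class sizes and the competitor rate three, which explains the 2
and 3 in `rateErr`; `1 + L` is the Lipschitz constant of `missRate` in its rate argument. -/
theorem exists_rate_pairTerm {W : X → Y → ℝ} (g : (X × Y → ℝ) → ℝ) {q : X → ℝ} (R : ℝ) {M : ℕ}
    (hM : 2 ≤ M) (L : ℕ) (hn : 0 < n) {P P' : X × Y → ℝ} (h : FeasibleTypes W q n P P') :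
    ∃ r, pairTerm W g q M L n P P' = Real.exp (-(n * r)) ∧
      |r - rateObjective W g R L P P'| ≤ rateErr X Y R L M n := by
  have hn' : (0 : ℝ) < n := by exact_mod_cast hn
  set E : ℝ := (Fintype.card X + Fintype.card Y + Fintype.card (X × Y) + 1) * typeErr n with hE
  have herr := typeErr_pos n
  have hX0 : (0 : ℝ) ≤ Fintype.card X := by positivity
  have hY0 : (0 : ℝ) ≤ Fintype.card Y := by positivity
  have hXY0 : (0 : ℝ) ≤ Fintype.card (X × Y) := by positivity
  obtain ⟨z, rfl⟩ := h.fst_mem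
  obtain ⟨z', rfl⟩ := h.snd_mem
  obtain ⟨-, -, hPX, hPX', hPY, -⟩ := h
  have hq : empiricalDist (fun i => (z i).1) = q := by rw [← hPX, marginalX_empiricalDist]
  have eP := (abs_log_card_typeClass_sub z).trans
    (show _ ≤ E by rw [hE]; gcongr; linarith)
  have eP' := (abs_log_card_typeClass_sub z').trans
    (show _ ≤ E by rw [hE]; gcongr; linarith)
  have eq := (abs_log_card_typeClass_sub fun i => (z i).1).trans
    (show _ ≤ E by rw [hE]; gcongr; linarith)
  have eY := (abs_log_card_typeClass_sub fun i => (z' i).2).trans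
    (show _ ≤ E by rw [hE]; gcongr; linarith)
  have pP := card_typeClass_pos z
  have pP' := card_typeClass_pos z'
  have pq := card_typeClass_pos fun i => (z i).1
  have pY := card_typeClass_pos fun i => (z' i).2
  rw [hq] at eq pq
  rw [← marginalY_empiricalDist] at eY pY
  set P := empiricalDist z
  set P' := empiricalDist z'
  set tP := ((typeClass n P).card : ℝ)
  set tP' := ((typeClass n P').card : ℝ)
  set tq := ((typeClass n q).card : ℝ)
  set tY := ((typeClass n (marginalY P')).card : ℝ)
  have pP : 0 < tP := Nat.cast_pos.2 pP
  have pP' : 0 < tP' := Nat.cast_pos.2 pP'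
  have pq : 0 < tq := Nat.cast_pos.2 pq
  have pY : 0 < tY := Nat.cast_pos.2 pY
  set S := ∑ a, P a * Real.log (W a.1 a.2) with hS
  have hM1 : 1 ≤ M - 1 := by omega
  have pM : 0 < ((M - 1 : ℕ) : ℝ) := by exact_mod_cast hM1
  set lM := Real.log ((M - 1 : ℕ) : ℝ) with hlM
  -- Chosen so that the expected number of competitors of type `P'` is exactly `exp (-n ρ)`.
  set ρ : ℝ := (-(lM + Real.log tP' - Real.log tq - Real.log tY)) / n with hρ
  set d : ℝ := (-(Real.log tP - Real.log tq)) / n - S with hd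
  refine ⟨d + missRate L ρ (g P - g P'), ?_, ?_⟩
  · have h1 : ((M - 1 : ℕ) : ℝ) * (tP' / (tq * tY)) = Real.exp (-(n * ρ)) := by
      rw [hρ, mul_div_cancel₀ _ hn'.ne', neg_neg, Real.exp_sub, Real.exp_sub, Real.exp_add,
        Real.exp_log pM, Real.exp_log pP', Real.exp_log pq, Real.exp_log pY]
      field_simp
    unfold pairTerm
    rw [show (n : ℝ) * (g P' - g P) = -(n * (g P - g P')) by ring,
      missTerm_eq_exp hn'.le L (M - 1) _ h1]
    have h2 : -(n * (d + missRate L ρ (g P - g P'))) =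
        (Real.log tP - Real.log tq) + n * S + -(n * missRate L ρ (g P - g P')) := by
      rw [hd]; field_simp; ring
    rw [h2, Real.exp_add, Real.exp_add, Real.exp_sub, Real.exp_log pP, Real.exp_log pq]
    ring
  · have hlog : |lM - Real.log M| ≤ Real.log 2 := by
      have hMr : (2 : ℝ) ≤ M := by exact_mod_cast hM
      have hc : ((M - 1 : ℕ) : ℝ) = M - 1 := by
        rw [Nat.cast_sub (by omega)]; simp
      have h1 : lM ≤ Real.log M := Real.log_le_log pM (by rw [hc]; linarith)
      have h2 : Real.log M ≤ Real.log 2 + lM := by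
        rw [hlM, ← Real.log_mul (by norm_num) pM.ne']
        exact Real.log_le_log (by linarith) (by rw [hc]; linarith)
      rw [abs_le]; constructor <;> linarith
    rw [abs_le] at eP eP' eq eY hlog
    have hdd : |d - channelDivergence W P| ≤ 2 * (E / n) := by
      have h1 : d - channelDivergence W P =
          (-(Real.log tP - n * entropy P) + (Real.log tq - n * entropy q)) / n := by
        rw [hd, channelDivergence, hPX]; field_simp; ring
      rw [h1, abs_div, abs_of_pos hn', ← mul_div_assoc]
      gcongr
      rw [abs_le]; constructor <;> linarith
    have hρρ : |ρ - (entropyInfo P' - R)| ≤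
        3 * (E / n) + (Real.log 2 / n + |Real.log M / n - R|) := by
      have h1 : ρ - (entropyInfo P' - R) =
          (-(Real.log tP' - n * entropy P') + (Real.log tq - n * entropy q) +
            (Real.log tY - n * entropy (marginalY P')) - (lM - Real.log M)) / n
            - (Real.log M / n - R) := by
        rw [hρ, entropyInfo, hPX']; field_simp; ring
      rw [h1]
      refine (abs_sub _ _).trans ?_
      rw [← add_assoc]
      gcongr
      rw [abs_div, abs_of_pos hn', ← mul_div_assoc, ← add_div]
      gcongr
      rw [abs_le]; constructor <;> linarith
    have hmr := abs_missRate_sub_le L ρ (entropyInfo P' - R) (g P - g P')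
    have hL : (0 : ℝ) ≤ 1 + L := by positivity
    calc |d + missRate L ρ (g P - g P') - rateObjective W g R L P P'|
        = |(d - channelDivergence W P) + (missRate L ρ (g P - g P') -
            missRate L (entropyInfo P' - R) (g P - g P'))| := by
          unfold rateObjective; congr 1; ring
      _ ≤ |d - channelDivergence W P| + |missRate L ρ (g P - g P') -
            missRate L (entropyInfo P' - R) (g P - g P')| := abs_add_le _ _
      _ ≤ 2 * (E / n) + (1 + L) *
            (3 * (E / n) + (Real.log 2 / n + |Real.log M / n - R|)) := by
          gcongr
          exact hmr.trans (mul_le_mul_of_nonneg_left hρρ hL)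
      _ = rateErr X Y R L M n := by
          unfold rateErr; rw [hE]; ring

theorem tendsto_typeErr_div : Tendsto (fun n : ℕ => typeErr n / n) atTop (𝓝 0) := by
  have h1 : Tendsto (fun x : ℝ => Real.log x / x) atTop (𝓝 0) := by
    simpa using Real.tendsto_pow_log_div_mul_add_atTop 1 0 1 one_ne_zero
  have h2 : Tendsto (fun n : ℕ => Real.log ((n : ℝ) + 1) / ((n : ℝ) + 1)) atTop (𝓝 0) :=
    h1.comp (tendsto_atTop_add_const_right _ _ tendsto_natCast_atTop_atTop)
  have h3 : Tendsto (fun n : ℕ => 1 / (n : ℝ)) atTop (𝓝 0) := tendsto_one_div_atTop_nhds_zero_nat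
  have h4 : Tendsto (fun n : ℕ => 2 * (Real.log ((n : ℝ) + 1) / ((n : ℝ) + 1)) * (1 + 1 / (n : ℝ))
      + 1 / (n : ℝ)) atTop (𝓝 (2 * 0 * (1 + 0) + 0)) :=
    ((h2.const_mul 2).mul (h3.const_add 1)).add h3
  simp only [mul_zero, zero_mul, add_zero] at h4
  refine h4.congr' ?_
  filter_upwards [eventually_gt_atTop 0] with n hn
  have : (0 : ℝ) < n := by exact_mod_cast hn
  unfold typeErr
  field_simp

theorem tendsto_rateErr (X Y : Type*) [Fintype X] [Fintype Y] {R : ℝ} (L : ℕ) {M : ℕ → ℕ}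
    (hR : Tendsto (fun n : ℕ => Real.log (M n) / n) atTop (𝓝 R)) :
    Tendsto (fun n => rateErr X Y R L (M n) n) atTop (𝓝 0) := by
  have h1 := tendsto_typeErr_div.const_mul
    ((Fintype.card X + Fintype.card Y + Fintype.card (X × Y) + 1 : ℝ))
  have h2 : Tendsto (fun n : ℕ => |Real.log (M n) / n - R|) atTop (𝓝 0) := by
    simpa using (hR.sub_const R).abs
  have h3 : Tendsto (fun n : ℕ => Real.log 2 / (n : ℝ)) atTop (𝓝 0) :=
    tendsto_const_div_atTop_nhds_zero_nat _
  have h4 := (h1.const_mul (2 + (1 + L) * 3 : ℝ)).add ((h3.add h2).const_mul (1 + L : ℝ))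
  simp only [mul_zero, add_zero] at h4
  refine h4.congr fun n => ?_
  unfold rateErr
  rw [mul_div_assoc]

end ListDecoding

end

/-! ### Continuity, attainment of the minimum, and stability under perturbed constraints. -/

noncomputable section

namespace ListDecoding

variable {X Y : Type*} [Fintype X] [DecidableEq X] [Fintype Y] [DecidableEq Y]

theorem continuous_entropy {α : Type*} [Fintype α] : Continuous (entropy : (α → ℝ) → ℝ) :=
  continuous_finsetSum _ fun a _ => Real.continuous_negMulLog.comp (continuous_apply a)

omit [Fintype X] [DecidableEq X] [DecidableEq Y] in
theorem continuous_marginalX : Continuous (marginalX : (X × Y → ℝ) → X → ℝ) :=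
  continuous_pi fun x => continuous_finsetSum _ fun y _ => continuous_apply (x, y)

omit [Fintype Y] [DecidableEq X] [DecidableEq Y] in
theorem continuous_marginalY : Continuous (marginalY : (X × Y → ℝ) → Y → ℝ) :=
  continuous_pi fun y => continuous_finsetSum _ fun x _ => continuous_apply (x, y)

omit [DecidableEq X] [DecidableEq Y] in
-- Entropies are continuous up to the boundary, and the term in `log W` is linear in the
-- distribution, so vanishing probabilities cause no trouble.
theorem continuousOn_rateObjective (W : X → Y → ℝ) {g : (X × Y → ℝ) → ℝ}
    (hg : ContinuousOn g (stdSimplex ℝ (X × Y))) (R : ℝ) (L : ℕ) :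
    ContinuousOn (fun p : (X × Y → ℝ) × (X × Y → ℝ) => rateObjective W g R L p.1 p.2)
      (stdSimplex ℝ (X × Y) ×ˢ stdSimplex ℝ (X × Y)) := by
  have h1 : ContinuousOn (fun p : (X × Y → ℝ) × (X × Y → ℝ) => g p.1)
      (stdSimplex ℝ (X × Y) ×ˢ stdSimplex ℝ (X × Y)) :=
    hg.comp continuousOn_fst fun p hp => hp.1
  have h2 : ContinuousOn (fun p : (X × Y → ℝ) × (X × Y → ℝ) => g p.2)
      (stdSimplex ℝ (X × Y) ×ˢ stdSimplex ℝ (X × Y)) :=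
    hg.comp continuousOn_snd fun p hp => hp.2
  have h3 : Continuous (channelDivergence W) := by
    unfold channelDivergence
    refine ((continuous_entropy.comp continuous_marginalX).sub continuous_entropy).sub ?_
    fun_prop
  have h4 : Continuous (entropyInfo : (X × Y → ℝ) → ℝ) :=
    ((continuous_entropy.comp continuous_marginalX).add
      (continuous_entropy.comp continuous_marginalY)).sub continuous_entropy
  have h5 : Continuous fun p : ℝ × ℝ => missRate L p.1 p.2 := by
    unfold missRate
    fun_prop
  unfold rateObjective
  refine (h3.comp continuous_fst).continuousOn.add ?_
  exact h5.comp_continuousOn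
    (((h4.comp continuous_snd).sub continuous_const).continuousOn.prodMk (h1.sub h2))

omit [Fintype X] [DecidableEq X] [DecidableEq Y] in
theorem le_marginalX {P : X × Y → ℝ} (hP : ∀ z, 0 ≤ P z) (z : X × Y) : P z ≤ marginalX P z.1 :=
  Finset.single_le_sum (f := fun y => P (z.1, y)) (fun _ _ => hP _) (Finset.mem_univ z.2)

omit [Fintype Y] [DecidableEq X] [DecidableEq Y] in
theorem le_marginalY {P : X × Y → ℝ} (hP : ∀ z, 0 ≤ P z) (z : X × Y) : P z ≤ marginalY P z.2 :=
  Finset.single_le_sum (f := fun x => P (x, z.2)) (fun _ _ => hP _) (Finset.mem_univ z.1)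

omit [DecidableEq X] [DecidableEq Y] in
theorem sum_mul_log_marginalX (P : X × Y → ℝ) :
    ∑ z, P z * Real.log (marginalX P z.1) = -entropy (marginalX P) := by
  rw [Fintype.sum_prod_type, entropy, ← Finset.sum_neg_distrib]
  refine Finset.sum_congr rfl fun x _ => ?_
  dsimp only
  rw [← Finset.sum_mul, Real.negMulLog]
  simp [marginalX]

omit [DecidableEq X] [DecidableEq Y] in
theorem sum_mul_log_marginalY (P : X × Y → ℝ) :
    ∑ z, P z * Real.log (marginalY P z.2) = -entropy (marginalY P) := by
  rw [Fintype.sum_prod_type_right, entropy, ← Finset.sum_neg_distrib]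
  refine Finset.sum_congr rfl fun x _ => ?_
  dsimp only
  rw [← Finset.sum_mul, Real.negMulLog]
  simp [marginalY]

theorem sum_mul_log_self {α : Type*} [Fintype α] (P : α → ℝ) :
    ∑ z, P z * Real.log (P z) = -entropy P := by
  rw [entropy, ← Finset.sum_neg_distrib]
  exact Finset.sum_congr rfl fun z _ => by rw [Real.negMulLog]; ring

omit [DecidableEq X] [DecidableEq Y] in
theorem mutualInfo_eq {P : X × Y → ℝ} (hP : ∀ z, 0 ≤ P z) : mutualInfo P = entropyInfo P := by
  have h : ∀ z, P z * Real.log (P z / (marginalX P z.1 * marginalY P z.2)) =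
      P z * Real.log (P z) - P z * Real.log (marginalX P z.1) -
        P z * Real.log (marginalY P z.2) := by
    intro z
    rcases (hP z).eq_or_lt with h0 | h0
    · rw [← h0]; ring
    · have h1 := h0.trans_le (le_marginalX hP z)
      have h2 := h0.trans_le (le_marginalY hP z)
      rw [Real.log_div h0.ne' (mul_pos h1 h2).ne', Real.log_mul h1.ne' h2.ne']
      ring
  unfold mutualInfo entropyInfo
  rw [Finset.sum_congr rfl fun z _ => h z, Finset.sum_sub_distrib, Finset.sum_sub_distrib,
    sum_mul_log_marginalX, sum_mul_log_marginalY, sum_mul_log_self]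
  ring

omit [DecidableEq X] [DecidableEq Y] in
-- Absolute continuity reduces to the support condition on `W`, since a zero of `P_X` already kills
-- the whole row of `P`.
theorem relEntropy_inputChannel {W : X → Y → ℝ} {P : X × Y → ℝ} (hP : ∀ z, 0 ≤ P z)
    (hs : ∀ x y, W x y = 0 → P (x, y) = 0) :
    relEntropy P (inputChannel (marginalX P) W) = (channelDivergence W P : EReal) := by
  have h0 : ∀ a, inputChannel (marginalX P) W a = 0 → P a = 0 := by
    rintro ⟨x, y⟩ h
    rcases mul_eq_zero.1 h with h | h
    · exact le_antisymm ((le_marginalX hP (x, y)).trans h.le) (hP _)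
    · exact hs _ _ h
  have h : ∀ z, P z * Real.log (P z / inputChannel (marginalX P) W z) =
      P z * Real.log (P z) - P z * Real.log (marginalX P z.1) -
        P z * Real.log (W z.1 z.2) := by
    intro z
    by_cases hz : P z = 0
    · rw [hz]; ring
    · have h1 : inputChannel (marginalX P) W z ≠ 0 := fun h => hz (h0 z h)
      rw [Real.log_div hz h1, inputChannel, Real.log_mul (left_ne_zero_of_mul h1)
        (right_ne_zero_of_mul h1)]
      ring
  rw [relEntropy, if_pos h0, Finset.sum_congr rfl fun z _ => h z, Finset.sum_sub_distrib,
    Finset.sum_sub_distrib, sum_mul_log_marginalX, sum_mul_log_self, channelDivergence]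
  congr 1
  ring

/-- Pairs of joint distributions `(P, P')` with `P` absolutely continuous with respect to the
channel `W`. -/
def channelPairs (W : X → Y → ℝ) : Set ((X × Y → ℝ) × (X × Y → ℝ)) :=
  {p | p ∈ stdSimplex ℝ (X × Y) ×ˢ stdSimplex ℝ (X × Y) ∧ ∀ x y, W x y = 0 → p.1 (x, y) = 0}

/-- The violation of the marginal constraints of the exponent, together with the `X`-marginals. -/
def constraintMap (p : (X × Y → ℝ) × (X × Y → ℝ)) : (X → ℝ) × (X → ℝ) × (Y → ℝ) :=
  (marginalX p.1, marginalX p.2, marginalY p.2 - marginalY p.1)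

/-- The pairs of joint distributions over which the exponent is a minimum of finite values. -/
def feasiblePairs (W : X → Y → ℝ) (Q : X → ℝ) : Set ((X × Y → ℝ) × (X × Y → ℝ)) :=
  channelPairs W ∩ constraintMap ⁻¹' {(Q, Q, 0)}

omit [DecidableEq X] [DecidableEq Y] in
theorem continuous_constraintMap : Continuous (constraintMap (X := X) (Y := Y)) :=
  (continuous_marginalX.comp continuous_fst).prodMk
    ((continuous_marginalX.comp continuous_snd).prodMk
      ((continuous_marginalY.comp continuous_snd).sub (continuous_marginalY.comp continuous_fst)))

omit [DecidableEq X] [DecidableEq Y] in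
theorem isCompact_channelPairs (W : X → Y → ℝ) : IsCompact (channelPairs W) := by
  have h : IsClosed {p : (X × Y → ℝ) × (X × Y → ℝ) | ∀ x y, W x y = 0 → p.1 (x, y) = 0} := by
    simp only [Set.ofPred_forall]
    refine isClosed_iInter fun x => isClosed_iInter fun y => isClosed_iInter fun _ => ?_
    exact isClosed_eq ((continuous_apply (x, y)).comp continuous_fst) continuous_const
  exact ((isCompact_stdSimplex ℝ (X × Y)).prod (isCompact_stdSimplex ℝ (X × Y))).inter_right h

omit [DecidableEq X] [DecidableEq Y] in
theorem isCompact_feasiblePairs (W : X → Y → ℝ) (Q : X → ℝ) : IsCompact (feasiblePairs W Q) :=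
  (isCompact_channelPairs W).inter_right (isClosed_singleton.preimage continuous_constraintMap)

omit [DecidableEq X] [DecidableEq Y] in
theorem mem_feasiblePairs {W : X → Y → ℝ} {Q : X → ℝ} {P P' : X × Y → ℝ} :
    (P, P') ∈ feasiblePairs W Q ↔ P ∈ jointWithInput Q ∧ P' ∈ jointWithMarginals Q P ∧
      ∀ x y, W x y = 0 → P (x, y) = 0 := by
  simp only [feasiblePairs, channelPairs, constraintMap, jointWithInput, jointWithMarginals,
    Set.mem_inter_iff, Set.mem_ofPred_eq, Set.mem_prod, Set.mem_preimage, Set.mem_singleton_iff,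
    Prod.mk.injEq, sub_eq_zero]
  tauto

omit [DecidableEq X] [DecidableEq Y] in
theorem feasiblePairs_nonempty {W : X → Y → ℝ} (hW : ∀ x, W x ∈ stdSimplex ℝ Y)
    {Q : X → ℝ} (hQ : Q ∈ stdSimplex ℝ X) : (feasiblePairs W Q).Nonempty := by
  have h1 : marginalX (inputChannel Q W) = Q := by
    funext x
    simp [marginalX, inputChannel, ← Finset.mul_sum, (hW x).2]
  have h2 : inputChannel Q W ∈ stdSimplex ℝ (X × Y) := by
    refine ⟨fun z => mul_nonneg (hQ.1 _) ((hW _).1 _), ?_⟩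
    rw [Fintype.sum_prod_type]
    exact (Finset.sum_congr rfl fun x _ => congrFun h1 x).trans hQ.2
  refine ⟨(inputChannel Q W, inputChannel Q W), mem_feasiblePairs.2
    ⟨⟨h2, h1⟩, ⟨h2, h1, rfl⟩, fun x y h => ?_⟩⟩
  simp [inputChannel, h]

omit [DecidableEq X] [DecidableEq Y] in
theorem exponentObjective_eq {W : X → Y → ℝ} (g : (X × Y → ℝ) → ℝ) (R : ℝ) {Q : X → ℝ} (L : ℕ)
    {P P' : X × Y → ℝ} (h : (P, P') ∈ feasiblePairs W Q) :
    exponentObjective W g R Q L P P' = (rateObjective W g R L P P' : EReal) := by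
  obtain ⟨⟨hP, rfl⟩, ⟨hP', -, -⟩, hs⟩ := mem_feasiblePairs.1 h
  rw [exponentObjective, relEntropy_inputChannel hP.1 hs, mutualInfo_eq hP'.1,
    ← EReal.coe_add, rateObjective, missRate, neg_sub]

omit [DecidableEq X] [DecidableEq Y] in
theorem exponentObjective_eq_top {W : X → Y → ℝ} (g : (X × Y → ℝ) → ℝ) (R : ℝ) (Q : X → ℝ)
    (L : ℕ) {P : X × Y → ℝ} (P' : X × Y → ℝ) (h : ¬ ∀ x y, W x y = 0 → P (x, y) = 0) :
    exponentObjective W g R Q L P P' = ⊤ := by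
  have h1 : ¬ ∀ a, inputChannel Q W a = 0 → P a = 0 := fun h' =>
    h fun x y hxy => h' (x, y) (by simp [inputChannel, hxy])
  rw [exponentObjective, relEntropy, if_neg h1]
  exact EReal.top_add_coe _

omit [DecidableEq X] [DecidableEq Y] in
theorem exists_isMinOn_rateObjective {W : X → Y → ℝ} (hW : ∀ x, W x ∈ stdSimplex ℝ Y)
    {g : (X × Y → ℝ) → ℝ} (hg : ContinuousOn g (stdSimplex ℝ (X × Y))) (R : ℝ)
    {Q : X → ℝ} (hQ : Q ∈ stdSimplex ℝ X) (L : ℕ) :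
    ∃ P P', (P, P') ∈ feasiblePairs W Q ∧
      ∀ p ∈ feasiblePairs W Q, rateObjective W g R L P P' ≤ rateObjective W g R L p.1 p.2 := by
  obtain ⟨⟨P, P'⟩, h1, h2⟩ := (isCompact_feasiblePairs W Q).exists_isMinOn
    (feasiblePairs_nonempty hW hQ)
    ((continuousOn_rateObjective W hg R L).mono fun p hp => hp.1.1)
  exact ⟨P, P', h1, fun p hp => h2 hp⟩

omit [DecidableEq X] [DecidableEq Y] in
theorem exponentE1_eq {W : X → Y → ℝ} {g : (X × Y → ℝ) → ℝ} {R : ℝ} {Q : X → ℝ} {L : ℕ}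
    {P P' : X × Y → ℝ} (h : (P, P') ∈ feasiblePairs W Q)
    (hmin : ∀ p ∈ feasiblePairs W Q,
      rateObjective W g R L P P' ≤ rateObjective W g R L p.1 p.2) :
    exponentE1 W g R Q L = (rateObjective W g R L P P' : EReal) := by
  obtain ⟨h1, h2, -⟩ := mem_feasiblePairs.1 h
  apply le_antisymm
  · rw [← exponentObjective_eq g R L h]
    exact (iInf₂_le P h1).trans (iInf₂_le P' h2)
  · refine le_iInf₂ fun S hS => le_iInf₂ fun S' hS' => ?_
    by_cases hs : ∀ x y, W x y = 0 → S (x, y) = 0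
    · have hf := mem_feasiblePairs.2 ⟨hS, hS', hs⟩
      have hle : rateObjective W g R L P P' ≤ rateObjective W g R L S S' := hmin (S, S') hf
      rw [exponentObjective_eq g R L hf, EReal.coe_le_coe_iff]
      exact hle
    · rw [exponentObjective_eq_top g R Q L S' hs]
      exact le_top

omit [DecidableEq X] [DecidableEq Y] in
/-- Pairs that almost satisfy the marginal constraints have an almost minimal objective. -/
theorem exists_pos_forall_sub_lt_rateObjective (W : X → Y → ℝ) {g : (X × Y → ℝ) → ℝ}
    (hg : ContinuousOn g (stdSimplex ℝ (X × Y))) (R : ℝ) {Q : X → ℝ} (L : ℕ) {e : ℝ}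
    (he : ∀ p ∈ feasiblePairs W Q, e ≤ rateObjective W g R L p.1 p.2) {ε : ℝ} (hε : 0 < ε) :
    ∃ η > 0, ∀ p ∈ channelPairs W, dist (constraintMap p) (Q, Q, 0) < η →
      e - ε < rateObjective W g R L p.1 p.2 := by
  obtain ⟨F, hF⟩ : ∃ F : (X × Y → ℝ) × (X × Y → ℝ) → ℝ,
      ∀ p, F p = rateObjective W g R L p.1 p.2 := ⟨_, fun _ => rfl⟩
  have hc : ContinuousOn F (channelPairs W) :=
    ((continuousOn_rateObjective W hg R L).mono fun p hp => hp.1).congr fun p _ => hF p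
  have hcl : IsClosed (channelPairs W ∩ F ⁻¹' Set.Iic (e - ε)) :=
    hc.preimage_isClosed_of_isClosed (isCompact_channelPairs W).isClosed isClosed_Iic
  have hK : IsCompact (channelPairs W ∩ F ⁻¹' Set.Iic (e - ε)) :=
    (isCompact_channelPairs W).of_isClosed_subset hcl Set.inter_subset_left
  -- The pairs with too small an objective form a compact set, so the constraint values they attain
  -- form a closed set. This set misses the exact constraint and therefore a ball around it.
  have himg := (hK.image continuous_constraintMap).isClosed
  have hnot : ((Q, Q, 0) : (X → ℝ) × (X → ℝ) × (Y → ℝ)) ∈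
      (constraintMap '' (channelPairs W ∩ F ⁻¹' Set.Iic (e - ε)))ᶜ := by
    rintro ⟨p, ⟨hp1, hp2⟩, hp3⟩
    have h1 := he p ⟨hp1, hp3⟩
    have h2 : F p ≤ e - ε := hp2
    rw [hF] at h2
    linarith
  obtain ⟨η, hη, hball⟩ := Metric.isOpen_iff.1 himg.isOpen_compl _ hnot
  refine ⟨η, hη, fun p hp hd => ?_⟩
  rw [← hF]
  by_contra h
  push Not at h
  exact hball (Metric.mem_ball.2 hd) ⟨p, ⟨hp, h⟩, rfl⟩

end ListDecoding

end

/-! ### Rounding feasible distributions to feasible types. -/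

noncomputable section

namespace ListDecoding

theorem exists_card_fiber_eq {α : Type*} [Fintype α] [DecidableEq α] {n : ℕ} (N : α → ℕ)
    (hN : ∑ a, N a = n) :
    ∃ z : Fin n → α, ∀ a, (Finset.univ.filter fun i => z i = a).card = N a := by
  have hcard : Fintype.card (Σ a, Fin (N a)) = Fintype.card (Fin n) := by simp [hN]
  let e : Fin n ≃ Σ a, Fin (N a) := (Fintype.equivOfCardEq hcard).symm
  refine ⟨fun i => (e i).1, fun a => ?_⟩
  rw [← Fintype.card_subtype, ← Fintype.card_fin (N a)]
  exact Fintype.card_congr ((e.subtypeEquiv (q := fun s => s.1 = a) fun i => Iff.rfl).trans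
    (Equiv.sigmaSubtype a))

theorem div_mem_types {α : Type*} [Fintype α] [DecidableEq α] {n : ℕ} {N : α → ℕ}
    (hN : ∑ a, N a = n) : (fun a => (N a : ℝ) / n) ∈ types α n := by
  obtain ⟨z, hz⟩ := exists_card_fiber_eq N hN
  exact ⟨z, funext fun a => by simp only [empiricalDist, hz]⟩

/-- Write two sequences of the same length with these symbol counts and count the aligned pairs. -/
theorem exists_coupling {X Y : Type*} [Fintype X] [DecidableEq X] [Fintype Y] [DecidableEq Y]
    (r : X → ℕ) (s : Y → ℕ) (h : ∑ x, r x = ∑ y, s y) :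
    ∃ B : X → Y → ℕ, (∀ x, ∑ y, B x y = r x) ∧ ∀ y, ∑ x, B x y = s y := by
  obtain ⟨u, hu⟩ := exists_card_fiber_eq r rfl
  obtain ⟨w, hw⟩ := exists_card_fiber_eq s h.symm
  refine ⟨fun x y => (Finset.univ.filter fun i => u i = x ∧ w i = y).card, fun x => ?_,
    fun y => ?_⟩
  · rw [← hu x, Finset.card_eq_sum_card_fiberwise (t := Finset.univ) (f := w) (by simp)]
    simp_rw [Finset.filter_filter]
  · rw [← hw y, Finset.card_eq_sum_card_fiberwise (t := Finset.univ) (f := u) (by simp)]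
    simp_rw [Finset.filter_filter, and_comm]

/-- Underfilling leaves room to correct the sum upwards. Subtraction is truncated, but a single
entry that stays positive gives up the whole of `c`. -/
theorem sum_floor_sub_le {α : Type*} [Fintype α] {v : α → ℝ} (hv : ∀ a, 0 ≤ v a) {c r : ℕ}
    (h : ∑ a, v a ≤ r + c) : ∑ a, (⌊v a⌋₊ - c) ≤ r := by
  classical
  by_cases h0 : ∀ a, ⌊v a⌋₊ - c = 0
  · rw [Finset.sum_eq_zero fun a _ => h0 a]; exact Nat.zero_le _
  · push Not at h0
    obtain ⟨b, hb⟩ := h0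
    have h1 : ∀ a, ((⌊v a⌋₊ - c : ℕ) : ℝ) ≤ v a := fun a =>
      le_trans (by exact_mod_cast Nat.sub_le _ _) (Nat.floor_le (hv a))
    have h2 : ((⌊v b⌋₊ - c : ℕ) : ℝ) ≤ v b - c := by
      rw [Nat.cast_sub (by omega)]
      linarith [Nat.floor_le (hv b)]
    have h3 : ∑ a, ((⌊v a⌋₊ - c : ℕ) : ℝ) ≤ r := by
      rw [← Finset.add_sum_erase _ _ (Finset.mem_univ b)] at h ⊢
      have := Finset.sum_le_sum fun a (_ : a ∈ Finset.univ.erase b) => h1 a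
      linarith
    exact_mod_cast h3

theorem floor_sub_bounds {v : ℝ} (hv : 0 ≤ v) (c : ℕ) :
    ((⌊v⌋₊ - c : ℕ) : ℝ) ≤ v ∧ v ≤ ((⌊v⌋₊ - c : ℕ) : ℝ) + (c + 1) := by
  refine ⟨le_trans (by exact_mod_cast Nat.sub_le _ _) (Nat.floor_le hv), ?_⟩
  have h1 := Nat.lt_floor_add_one v
  have h2 : (⌊v⌋₊ : ℝ) ≤ ((⌊v⌋₊ - c : ℕ) : ℝ) + c := by
    exact_mod_cast (show ⌊v⌋₊ ≤ ⌊v⌋₊ - c + c by omega)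
  linarith

/-- Underfill, then add the whole deficit at one coordinate where `v` is nonzero; this hits the sum
exactly while preserving zeros. -/
theorem exists_nat_sum_eq {Y : Type*} [Fintype Y] [DecidableEq Y] {v : Y → ℝ}
    (hv : ∀ y, 0 ≤ v y) {r : ℕ} (hr : |(r : ℝ) - ∑ y, v y| ≤ 1) (h0 : r ≠ 0 → ∃ y, v y ≠ 0) :
    ∃ N : Y → ℕ, ∑ y, N y = r ∧ (∀ y, v y = 0 → N y = 0) ∧
      ∀ y, |(N y : ℝ) - v y| ≤ 2 * Fintype.card Y + 3 := by
  rw [abs_le] at hr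
  have hle : ∀ y, v y ≤ ∑ y, v y := fun y =>
    Finset.single_le_sum (f := v) (fun y _ => hv y) (Finset.mem_univ y)
  have hc : (0 : ℝ) ≤ Fintype.card Y := Nat.cast_nonneg _
  by_cases hr0 : r = 0
  · subst hr0
    refine ⟨fun _ => 0, by simp, fun _ _ => rfl, fun y => ?_⟩
    have := hle y
    have := hv y
    have := hr.1
    push_cast at *
    rw [abs_le]; constructor <;> linarith
  obtain ⟨b, hb⟩ := h0 hr0
  have hsum : ∑ y, (⌊v y⌋₊ - 1) ≤ r := sum_floor_sub_le hv (by push_cast; linarith)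
  have hsumR : ∑ y, v y ≤ ∑ y, ((⌊v y⌋₊ - 1 : ℕ) : ℝ) + 2 * Fintype.card Y := by
    have := Finset.sum_le_sum fun y (_ : y ∈ Finset.univ) => (floor_sub_bounds (hv y) 1).2
    rw [Finset.sum_add_distrib] at this
    simp only [Finset.sum_const, Finset.card_univ, nsmul_eq_mul] at this
    push_cast at this ⊢
    linarith
  have hd : ((r - ∑ y, (⌊v y⌋₊ - 1) : ℕ) : ℝ) ≤ 2 * Fintype.card Y + 1 := by
    rw [Nat.cast_sub hsum]
    push_cast at hsumR ⊢
    linarith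
  refine ⟨fun y => (⌊v y⌋₊ - 1) + if y = b then r - ∑ y, (⌊v y⌋₊ - 1) else 0, ?_, ?_, ?_⟩
  · rw [Finset.sum_add_distrib, Finset.sum_ite_eq' Finset.univ b, if_pos (Finset.mem_univ b)]
    omega
  · intro y hy
    have : y ≠ b := fun h => hb (h ▸ hy)
    simp [this, hy]
  · intro y
    obtain ⟨h1, h2⟩ := floor_sub_bounds (hv y) 1
    have h3 : (0 : ℝ) ≤ ((if y = b then r - ∑ y, (⌊v y⌋₊ - 1) else 0 : ℕ) : ℝ) :=
      Nat.cast_nonneg _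
    have h4 : ((if y = b then r - ∑ y, (⌊v y⌋₊ - 1) else 0 : ℕ) : ℝ) ≤
        2 * Fintype.card Y + 1 := by
      split_ifs
      · exact hd
      · push_cast; positivity
    rw [Nat.cast_add]
    push_cast at h2
    rw [abs_le]; constructor <;> linarith

/-- Underfill all rows and columns at once, then add a coupling of the row and column deficits. Each
added entry is at most its row deficit, hence bounded. -/
theorem exists_nat_matrix {X Y : Type*} [Fintype X] [DecidableEq X] [Fintype Y] [DecidableEq Y]
    {v : X → Y → ℝ} (hv : ∀ x y, 0 ≤ v x y) {r : X → ℕ} {s : Y → ℕ}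
    (hrs : ∑ x, r x = ∑ y, s y) (c : ℕ) (hr : ∀ x, |(r x : ℝ) - ∑ y, v x y| ≤ c)
    (hs : ∀ y, |(s y : ℝ) - ∑ x, v x y| ≤ c) :
    ∃ N : X → Y → ℕ, (∀ x, ∑ y, N x y = r x) ∧ (∀ y, ∑ x, N x y = s y) ∧
      ∀ x y, |(N x y : ℝ) - v x y| ≤ c + Fintype.card Y * (c + 1) + (c + 1) := by
  set A : X → Y → ℕ := fun x y => ⌊v x y⌋₊ - c with hA
  have hrow : ∀ x, ∑ y, A x y ≤ r x := fun x =>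
    sum_floor_sub_le (hv x) (by linarith [(abs_le.1 (hr x)).1])
  have hcol : ∀ y, ∑ x, A x y ≤ s y := fun y =>
    sum_floor_sub_le (fun x => hv x y) (by linarith [(abs_le.1 (hs y)).1])
  have htot : ∑ x, (r x - ∑ y, A x y) = ∑ y, (s y - ∑ x, A x y) := by
    rw [Finset.sum_tsub_distrib _ fun x _ => hrow x, Finset.sum_tsub_distrib _ fun y _ => hcol y,
      hrs, Finset.sum_comm]
  obtain ⟨B, hB1, hB2⟩ := exists_coupling _ _ htot
  refine ⟨fun x y => A x y + B x y, fun x => ?_, fun y => ?_, fun x y => ?_⟩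
  · rw [Finset.sum_add_distrib, hB1]
    exact Nat.add_sub_cancel' (hrow x)
  · rw [Finset.sum_add_distrib, hB2]
    exact Nat.add_sub_cancel' (hcol y)
  · have h1 : B x y ≤ r x - ∑ y, A x y := by
      rw [← hB1 x]
      exact Finset.single_le_sum (f := fun y => B x y) (fun _ _ => Nat.zero_le _)
        (Finset.mem_univ y)
    have h2 : (B x y : ℝ) ≤ r x - ∑ y, (A x y : ℝ) := by
      have : (B x y : ℝ) ≤ ((r x - ∑ y, A x y : ℕ) : ℝ) := by exact_mod_cast h1
      rwa [Nat.cast_sub (hrow x), Nat.cast_sum] at this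
    have h3 : ∑ y, v x y ≤ ∑ y, (A x y : ℝ) + Fintype.card Y * (c + 1) := by
      have := Finset.sum_le_sum fun y (_ : y ∈ Finset.univ) => (floor_sub_bounds (hv x y) c).2
      rwa [Finset.sum_add_distrib, Finset.sum_const, Finset.card_univ, nsmul_eq_mul] at this
    have h4 := (abs_le.1 (hr x)).2
    obtain ⟨h5, h6⟩ := floor_sub_bounds (hv x y) c
    have h5 : (A x y : ℝ) ≤ v x y := h5
    have h6 : v x y ≤ (A x y : ℝ) + (c + 1) := h6
    have h7 : (0 : ℝ) ≤ B x y := Nat.cast_nonneg _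
    have h8 : (0 : ℝ) ≤ Fintype.card Y * (c + 1) := by positivity
    have h9 : (0 : ℝ) ≤ c := Nat.cast_nonneg _
    rw [Nat.cast_add, abs_le]
    constructor <;> linarith

variable {X Y : Type*} [Fintype X] [DecidableEq X] [Fintype Y] [DecidableEq Y]

/-- Feasible pairs of distributions are approximated by feasible pairs of types. -/
theorem exists_feasibleTypes_near {W : X → Y → ℝ} {Q : X → ℝ} {P P' : X × Y → ℝ}
    (h : (P, P') ∈ feasiblePairs W Q) :
    ∃ C : ℝ, ∀ n : ℕ, 0 < n → ∀ q ∈ types X n, (∀ x, q x = 0 ↔ Q x = 0) →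
      (∀ x, |q x - Q x| ≤ 1 / (n : ℝ)) →
      ∃ S S', FeasibleTypes W q n S S' ∧ (∀ z, |S z - P z| ≤ C / n) ∧
        ∀ z, |S' z - P' z| ≤ C / n := by
  obtain ⟨⟨hP, hPX⟩, ⟨hP', hPX', hPY⟩, hs⟩ := mem_feasiblePairs.1 h
  -- Bounds both margin errors for `P'`: at most 1 in a row, and the accumulated rounding error of
  -- `P` in a column.
  set c : ℕ := Fintype.card X * (2 * Fintype.card Y + 3) + 1 with hc
  refine ⟨max (2 * Fintype.card Y + 3) (c + Fintype.card Y * (c + 1) + (c + 1)), ?_⟩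
  intro n hn q hq hsupp hqQ
  have hn' : (0 : ℝ) < n := by exact_mod_cast hn
  obtain ⟨w, rfl⟩ : ∃ w : Fin n → X, empiricalDist w = q := hq
  set r : X → ℕ := fun x => (Finset.univ.filter fun i => w i = x).card with hr
  have hrq : ∀ x, (n : ℝ) * empiricalDist w x = r x := natCast_mul_empiricalDist w
  have hrQ : ∀ x, |(r x : ℝ) - n * Q x| ≤ 1 := by
    intro x
    rw [← hrq, ← mul_sub, abs_mul, abs_of_pos hn']
    have := mul_le_mul_of_nonneg_left (hqQ x) hn'.le
    rwa [mul_one_div_cancel hn'.ne'] at this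
  -- `P` is rounded first, row by row, keeping its zeros so that the channel support is respected.
  -- The equality of supports ensures that a row with positive count has a nonzero entry to receive
  -- the deficit.
  have hrow : ∀ x, ∃ N : Y → ℕ, ∑ y, N y = r x ∧ (∀ y, n * P (x, y) = 0 → N y = 0) ∧
      ∀ y, |(N y : ℝ) - n * P (x, y)| ≤ 2 * Fintype.card Y + 3 := by
    intro x
    refine exists_nat_sum_eq (fun y => mul_nonneg hn'.le (hP.1 _)) ?_ ?_
    · rw [← Finset.mul_sum]
      have : ∑ y, P (x, y) = Q x := congrFun hPX x
      rw [this]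
      exact hrQ x
    · intro hrx
      by_contra hcon
      push Not at hcon
      have hQx : Q x = 0 := by
        rw [← hPX]
        refine Finset.sum_eq_zero fun y _ => ?_
        exact (mul_eq_zero.1 (hcon y)).resolve_left hn'.ne'
      have := hrq x
      rw [(hsupp x).2 hQx, mul_zero] at this
      exact hrx (by exact_mod_cast this.symm)
  choose N hN1 hN2 hN3 using hrow
  have hrn : ∑ x, r x = n := sum_card_fiber w
  have hcast : (c : ℝ) = Fintype.card X * (2 * Fintype.card Y + 3) + 1 := by rw [hc]; push_cast; ring
  have hc1 : (1 : ℝ) ≤ c := by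
    rw [hcast]; linarith [show (0 : ℝ) ≤ Fintype.card X * (2 * Fintype.card Y + 3) by positivity]
  -- `P'` is rounded second, to the exact column sums produced by the rounding of `P`. It carries no
  -- support constraint, so new nonzero entries are harmless.
  obtain ⟨N', hN'1, hN'2, hN'3⟩ := exists_nat_matrix (v := fun x y => n * P' (x, y)) (r := r)
    (s := fun y => ∑ x, N x y) (fun x y => mul_nonneg hn'.le (hP'.1 _))
    (by rw [Finset.sum_comm]; exact Finset.sum_congr rfl fun x _ => (hN1 x).symm) c
    (by
      intro x
      rw [← Finset.mul_sum]
      have : ∑ y, P' (x, y) = Q x := congrFun hPX' x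
      rw [this]
      exact (hrQ x).trans hc1)
    (by
      intro y
      rw [← Finset.mul_sum]
      have : ∑ x, P' (x, y) = ∑ x, P (x, y) := congrFun hPY y
      rw [this, Finset.mul_sum, Nat.cast_sum, ← Finset.sum_sub_distrib]
      refine (Finset.abs_sum_le_sum_abs _ _).trans
        ((Finset.sum_le_sum fun x _ => hN3 x y).trans ?_)
      rw [Finset.sum_const, Finset.card_univ, nsmul_eq_mul, hcast]
      linarith)
  have hdiv : ∀ (k : ℕ) (p D : ℝ), |(k : ℝ) - n * p| ≤ D → |(k : ℝ) / n - p| ≤ D / n := by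
    intro k p D hk
    have : (k : ℝ) / n - p = (k - n * p) / n := by field_simp
    rw [this, abs_div, abs_of_pos hn']
    gcongr
  have hmX : ∀ {K : X → Y → ℕ}, (∀ x, ∑ y, K x y = r x) →
      marginalX (fun z : X × Y => (K z.1 z.2 : ℝ) / n) = empiricalDist w := by
    intro K hK
    funext x
    rw [marginalX, ← Finset.sum_div, ← Nat.cast_sum, hK x]
    rfl
  have htypes : ∀ {K : X → Y → ℕ}, (∀ x, ∑ y, K x y = r x) →
      (fun z : X × Y => (K z.1 z.2 : ℝ) / n) ∈ types (X × Y) n := by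
    intro K hK
    refine div_mem_types (N := fun z : X × Y => K z.1 z.2) ?_
    rw [Fintype.sum_prod_type, ← hrn]
    exact Finset.sum_congr rfl fun x _ => hK x
  refine ⟨fun z => (N z.1 z.2 : ℝ) / n, fun z => (N' z.1 z.2 : ℝ) / n, ⟨htypes hN1, htypes hN'1,
    hmX hN1, hmX hN'1, ?_, ?_⟩, fun z => ?_, fun z => ?_⟩
  · funext y
    rw [marginalY, marginalY, ← Finset.sum_div, ← Finset.sum_div, ← Nat.cast_sum, ← Nat.cast_sum,
      hN'2 y]
  · intro x y hxy
    rw [hN2 x y (by rw [hs x y hxy, mul_zero])]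
    simp
  · exact (hdiv _ _ _ (hN3 z.1 z.2)).trans (by gcongr; exact le_max_left _ _)
  · exact (hdiv _ _ _ (hN'3 z.1 z.2)).trans (by gcongr; exact le_max_right _ _)

end ListDecoding

end

/-! ### Matching exponential bounds on the error probability, and the limit. -/

noncomputable section

namespace ListDecoding

variable {X Y : Type*} [Fintype X] [DecidableEq X] [Fintype Y] [DecidableEq Y]

section Asymptotics

variable {W : X → Y → ℝ} {g : (X × Y → ℝ) → ℝ} {Q : X → ℝ} {Qn : ℕ → X → ℝ} {L : ℕ} {R : ℝ}
  {M : ℕ → ℕ} (hW : ∀ x, W x ∈ stdSimplex ℝ Y) (hg : ContinuousOn g (stdSimplex ℝ (X × Y)))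
  (hQn : ∀ᶠ n in atTop, Qn n ∈ types X n ∧
      (∀ x, Qn n x = 0 ↔ Q x = 0) ∧ ∀ x, |Qn n x - Q x| ≤ 1 / (n : ℝ))
  (hM : ∀ᶠ n in atTop, 2 ≤ M n)
  (hR : Tendsto (fun n : ℕ => Real.log (M n) / n) atTop (𝓝 R))
include hW hg hQn hM hR

theorem eventually_exp_le_avgErrorProb {P P' : X × Y → ℝ} (h : (P, P') ∈ feasiblePairs W Q)
    {ε : ℝ} (hε : 0 < ε) :
    ∀ᶠ n : ℕ in atTop, Real.exp (-(n * (rateObjective W g R L P P' + ε))) ≤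
      avgErrorProb W g (Qn n) (M n) L n := by
  obtain ⟨C, hC⟩ := exists_feasibleTypes_near h
  have hcont := (continuousOn_rateObjective W hg R L) (P, P') h.1.1
  -- The three thirds of `ε` pay for the rounding to types, the finite-length rate error, and the
  -- constant `8 * 8 ^ L`.
  obtain ⟨δ, hδ, hnear⟩ := Metric.continuousWithinAt_iff.1 hcont (ε / 3) (by positivity)
  have e1 : ∀ᶠ n : ℕ in atTop, C / (n : ℝ) < δ :=
    (tendsto_const_div_atTop_nhds_zero_nat C).eventually_lt_const hδ
  have e2 : ∀ᶠ n : ℕ in atTop, rateErr X Y R L (M n) n < ε / 3 :=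
    (tendsto_rateErr X Y L hR).eventually_lt_const (by positivity)
  have e3 : ∀ᶠ n : ℕ in atTop, Real.log (8 * 8 ^ L) / (n : ℝ) < ε / 3 :=
    (tendsto_const_div_atTop_nhds_zero_nat _).eventually_lt_const (by positivity)
  filter_upwards [e1, e2, e3, hQn, hM, eventually_gt_atTop 0] with n h1 h2 h3 hq hMn hn
  have hn' : (0 : ℝ) < n := by exact_mod_cast hn
  obtain ⟨S, S', hf, hS, hS'⟩ := hC n hn (Qn n) hq.1 hq.2.1 hq.2.2
  obtain ⟨r, hr1, hr2⟩ := exists_rate_pairTerm g R hMn L hn hf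
  have hmem : (S, S') ∈ stdSimplex ℝ (X × Y) ×ˢ stdSimplex ℝ (X × Y) := by
    obtain ⟨z, hz⟩ := hf.fst_mem
    obtain ⟨z', hz'⟩ := hf.snd_mem
    exact ⟨hz ▸ empiricalDist_mem_stdSimplex hn z, hz' ▸ empiricalDist_mem_stdSimplex hn z'⟩
  have hd : dist (S, S') (P, P') < δ := by
    rw [Prod.dist_eq]
    exact max_lt ((dist_pi_lt_iff hδ).2 fun z => (hS z).trans_lt h1)
      ((dist_pi_lt_iff hδ).2 fun z => (hS' z).trans_lt h1)
  have h4 := hnear hmem hd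
  rw [Real.dist_eq] at h4
  have h4 := (abs_lt.1 h4).2
  have h5 := (abs_le.1 hr2).2
  dsimp only at h4
  have h6 := le_avgErrorProb (fun x y => (hW x).1 y) (g := g) hq.1 (by omega : 1 ≤ M n) L hf
  refine le_trans ?_ h6
  rw [hr1, le_div_iff₀ (by positivity), ← Real.exp_log (show (0 : ℝ) < 8 * 8 ^ L by positivity),
    ← Real.exp_add, Real.exp_le_exp]
  rw [div_lt_iff₀ hn'] at h3
  have h7 : n * r ≤ n * (rateObjective W g R L P P' + 2 * (ε / 3)) :=
    mul_le_mul_of_nonneg_left (by linarith) hn'.le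
  linarith

theorem eventually_avgErrorProb_le_exp (hL : 1 ≤ L) {e : ℝ}
    (he : ∀ p ∈ feasiblePairs W Q, e ≤ rateObjective W g R L p.1 p.2) {ε : ℝ} (hε : 0 < ε) :
    ∀ᶠ n : ℕ in atTop, avgErrorProb W g (Qn n) (M n) L n ≤ Real.exp (-(n * (e - ε))) := by
  -- Here the thirds of `ε` pay for the violated constraints, the finite-length rate error, and the
  -- polynomial prefactor.
  obtain ⟨η, hη, htube⟩ := exists_pos_forall_sub_lt_rateObjective W hg R L he
    (show 0 < ε / 3 by positivity)
  have e1 : ∀ᶠ n : ℕ in atTop, 1 / (n : ℝ) < η :=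
    (tendsto_const_div_atTop_nhds_zero_nat 1).eventually_lt_const hη
  have e2 : ∀ᶠ n : ℕ in atTop, rateErr X Y R L (M n) n < ε / 3 :=
    (tendsto_rateErr X Y L hR).eventually_lt_const (by positivity)
  set D : ℕ := Fintype.card (X × Y) * (L + 2) with hD
  have e3 : ∀ᶠ n : ℕ in atTop,
      Real.log (16 * L.factorial) / (n : ℝ) + D * (typeErr n / n) < ε / 3 := by
    have h := (tendsto_const_div_atTop_nhds_zero_nat (Real.log (16 * L.factorial))).add
      (tendsto_typeErr_div.const_mul (D : ℝ))
    simp only [mul_zero, add_zero] at h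
    exact h.eventually_lt_const (by positivity)
  filter_upwards [e1, e2, e3, hQn, hM, eventually_gt_atTop 0] with n h1 h2 h3 hq hMn hn
  have hn' : (0 : ℝ) < n := by exact_mod_cast hn
  have hB : ∀ S S', FeasibleTypes W (Qn n) n S S' →
      pairTerm W g (Qn n) (M n) L n S S' ≤ Real.exp (-(n * (e - 2 * (ε / 3)))) := by
    intro S S' hf
    obtain ⟨r, hr1, hr2⟩ := exists_rate_pairTerm g R hMn L hn hf
    have hmem : (S, S') ∈ channelPairs W := by
      obtain ⟨z, hz⟩ := hf.fst_mem
      obtain ⟨z', hz'⟩ := hf.snd_mem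
      exact ⟨⟨hz ▸ empiricalDist_mem_stdSimplex hn z, hz' ▸ empiricalDist_mem_stdSimplex hn z'⟩,
        hf.eq_zero⟩
    have hqQ : dist (Qn n) Q < η := (dist_pi_lt_iff hη).2 fun x => (hq.2.2 x).trans_lt h1
    have hd : dist (constraintMap (S, S')) (Q, Q, 0) < η := by
      rw [constraintMap, hf.fst_marginalX, hf.snd_marginalX, hf.marginalY_eq, sub_self,
        Prod.dist_eq, Prod.dist_eq]
      exact max_lt hqQ (max_lt hqQ (by simpa using hη))
    have h4 := htube _ hmem hd
    have h5 := (abs_le.1 hr2).1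
    dsimp only at h4
    rw [hr1, Real.exp_le_exp, neg_le_neg_iff]
    exact mul_le_mul_of_nonneg_left (by linarith) hn'.le
  have h6 := avgErrorProb_le (fun x y => (hW x).1 y) hq.1 hL (Real.exp_pos _).le hB
  refine h6.trans ?_
  have hK : ((typeFinset (X × Y) n).card : ℝ) ^ (L + 2) ≤ Real.exp (D * typeErr n) := by
    have h7 : ((typeFinset (X × Y) n).card : ℝ) ≤ ((n : ℝ) + 1) ^ Fintype.card (X × Y) := by
      exact_mod_cast card_typeFinset_le
    have h8 : 0 ≤ Real.log ((n : ℝ) + 1) := Real.log_nonneg (by linarith)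
    calc _ ≤ (((n : ℝ) + 1) ^ Fintype.card (X × Y)) ^ (L + 2) :=
          pow_le_pow_left₀ (Nat.cast_nonneg _) h7 _
      _ = Real.exp (D * Real.log (n + 1)) := by
          rw [← pow_mul, ← hD, Real.exp_nat_mul, Real.exp_log (by positivity)]
      _ ≤ _ := by
          refine Real.exp_le_exp.2 (mul_le_mul_of_nonneg_left ?_ (Nat.cast_nonneg _))
          unfold typeErr
          linarith
  calc _ ≤ Real.exp (Real.log (16 * L.factorial)) * Real.exp (D * typeErr n) *
          Real.exp (-(n * (e - 2 * (ε / 3)))) := by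
        rw [Real.exp_log (by positivity)]
        gcongr
    _ ≤ _ := by
        rw [← Real.exp_add, ← Real.exp_add, Real.exp_le_exp]
        rw [← mul_div_assoc, ← add_div, div_lt_iff₀ hn'] at h3
        linarith

end Asymptotics

end ListDecoding

end

theorem theorem1 {X Y : Type*} [Fintype X] [DecidableEq X] [Fintype Y] [DecidableEq Y]
    (W : X → Y → ℝ) (hW : ∀ x, W x ∈ stdSimplex ℝ Y)
    (g : (X × Y → ℝ) → ℝ) (hg : ContinuousOn g (stdSimplex ℝ (X × Y)))
    (Q : X → ℝ) (hQ : Q ∈ stdSimplex ℝ X)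
    (Qn : ℕ → X → ℝ)
    (hQn : ∀ᶠ n in atTop, Qn n ∈ ListDecoding.types X n ∧
      (∀ x, Qn n x = 0 ↔ Q x = 0) ∧ ∀ x, |Qn n x - Q x| ≤ 1 / (n : ℝ))
    (L : ℕ) (hL : 1 ≤ L)
    (R : ℝ) (M : ℕ → ℕ) (hM : ∀ᶠ n in atTop, 2 ≤ M n)
    (hR : Tendsto (fun n : ℕ => Real.log (M n) / n) atTop (𝓝 R)) :
    (∃ P ∈ ListDecoding.jointWithInput (Y := Y) Q, ∃ P' ∈ ListDecoding.jointWithMarginals Q P,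
      ListDecoding.exponentObjective W g R Q L P P' = ListDecoding.exponentE1 W g R Q L) ∧
    (∀ᶠ n in atTop, 0 < ListDecoding.avgErrorProb W g (Qn n) (M n) L n) ∧
    Tendsto
      (fun n : ℕ =>
        ((-(1 / (n : ℝ)) * Real.log (ListDecoding.avgErrorProb W g (Qn n) (M n) L n) : ℝ) : EReal))
      atTop (𝓝 (ListDecoding.exponentE1 W g R Q L)) := by
  open ListDecoding in
  obtain ⟨P, P', hmem, hmin⟩ := exists_isMinOn_rateObjective hW hg R hQ L
  have hE := exponentE1_eq hmem hmin
  have hlow := fun {ε : ℝ} (hε : 0 < ε) =>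
    eventually_exp_le_avgErrorProb (L := L) hW hg hQn hM hR hmem hε
  have hup := fun {ε : ℝ} (hε : 0 < ε) =>
    eventually_avgErrorProb_le_exp hW hg hQn hM hR hL hmin hε
  obtain ⟨h1, h2, -⟩ := mem_feasiblePairs.1 hmem
  refine ⟨⟨P, h1, P', h2, by rw [hE, exponentObjective_eq g R L hmem]⟩, ?_, ?_⟩
  · filter_upwards [hlow one_pos] with n hn
    exact (Real.exp_pos _).trans_le hn
  · rw [hE]
    refine (continuous_coe_real_ereal.tendsto _).comp (Metric.tendsto_nhds.2 fun ε hε => ?_)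
    have hε2 : 0 < ε / 2 := by positivity
    filter_upwards [hlow hε2, hup hε2, eventually_gt_atTop 0] with n hl hu hn
    have hn' : (0 : ℝ) < n := by exact_mod_cast hn
    have hpos := (Real.exp_pos _).trans_le hl
    have hl' := Real.log_le_log (Real.exp_pos _) hl
    have hu' := Real.log_le_log hpos hu
    rw [Real.log_exp] at hl' hu'
    have hrw : -(1 / (n : ℝ)) * Real.log (avgErrorProb W g (Qn n) (M n) L n) =
        -Real.log (avgErrorProb W g (Qn n) (M n) L n) / n := by ring
    rw [hrw, Real.dist_eq]
    refine lt_of_le_of_lt (abs_le.2 ⟨?_, ?_⟩) (half_lt_self hε)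
    · rw [neg_le_sub_iff_le_add, ← sub_le_iff_le_add, le_div_iff₀ hn']
      linarith
    · rw [sub_le_iff_le_add, div_le_iff₀ hn']
      linarith
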